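/- Let $\mathcal Q_2$ be the 2-adic ring $C^*$-algebra, i.e. the universal $C^*$-algebra generated by a unitary $U$ and an isometry $S_2$ with $S_2U=U^2S_2$ and $S_2S_2^*+US_2S_2^*U^*=1$, and view the Cuntz algebra $\mathcal O_2$ as included in $\mathcal Q_2$ with generating isometries $S_1=US_2$ and $S_2$. Let $\rho:\mathcal Q_2\to\mathcal B(\mathcal H)$ be a permutative representation: $\mathcal H$ has an orthonormal basis $\{e_n\}_{n\in\mathbb N}$, fixed from now on, such that $\rho(S_2)e_n=e_{\sigma_2(n)}$ and $\rho(U)e_n=e_{\tau(n)}$ for all $n$, where $\sigma_2:\mathbb N\to\mathbb N$ is an injection and $\tau$ is a bijection of $\mathbb N$. Put $\sigma_1=\tau\circ\sigma_2$, so that $\rho(S_i)e_n=e_{\sigma_i(n)}$ for $i=1,2$. The coding map $\sigma:\mathbb N\to\{1,2\}^{\mathbb N}$ sends $n$ to the unique sequence $(i_1,i_2,\dots)$ such that $n$ lies in the range of $\sigma_{i_1}\circ\cdots\circ\sigma_{i_k}$ for every $k\ge 1$. The restriction $\rho|_{\mathcal O_2}$ is called regular (in the sense of Bratteli–Jorgensen)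 if, for all $n$ and all $i_1,\dots,i_k\in\{1,2\}$, $\sigma(n)=\sigma(\sigma_{i_1}\circ\cdots\circ\sigma_{i_k}(n))$ implies $n=\sigma_{i_1}\circ\cdots\circ\sigma_{i_k}(n)$; it is called multiplicity-free if $\sigma$ is injective. A permutative subrepresentation of $\rho$ is the restriction of $\rho$ to a $\rho(\mathcal Q_2)$-invariant subspace of the form $\overline{\mathrm{span}}\{e_i: i\in I\}$ with $I\subset\mathbb N$. Then: (a) $\rho|_{\mathcal O_2}$ is regular if and only if $\rho$ is the (Hilbert space) direct sum of irreducible permutative subrepresentations; (b) $\rho|_{\mathcal O_2}$ is multiplicity-free if and only if $\rho$ is the direct sum of pairwise unitarily inequivalent irreducible permutative subrepresentations. -/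

import Mathlib

open scoped ENNReal

universe u v w

/-! ## Universal C*-algebras on two generators -/

namespace UniversalCStar

/-- A nonzero unital C*-algebra with a pair of contractions satisfying the relations `R`.
(The zero algebra contributes nothing to the universal norm.) -/
structure Model (R : ∀ (A : Type u) [CStarAlgebra A], A → A → Prop) : Type (u + 1) where
  carrier : Type u
  [cstar : CStarAlgebra carrier]
  [nontriv : Nontrivial carrier]
  x : carrier
  y : carrier
  rel : R carrier x y
  norm_x : ‖x‖ ≤ 1
  norm_y : ‖y‖ ≤ 1

attribute [instance] Model.cstar Model.nontriv

variable (R : ∀ (A : Type u) [CStarAlgebra A], A → A → Prop)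

/-- The C*-algebra of bounded families indexed by all models. -/
abbrev Ambient : Type (u + 1) := lp (fun m : Model R => m.carrier) ∞

noncomputable instance : CStarAlgebra (Ambient R) where

/-- The family of first generators. -/
def ambX : Ambient R :=
  ⟨fun m => m.x, memℓp_infty ⟨1, by rintro _ ⟨m, rfl⟩; exact m.norm_x⟩⟩

/-- The family of second generators. -/
def ambY : Ambient R :=
  ⟨fun m => m.y, memℓp_infty ⟨1, by rintro _ ⟨m, rfl⟩; exact m.norm_y⟩⟩

/-- The C*-subalgebra generated by the two universal families. -/
noncomputable abbrev sub : StarSubalgebra ℂ (Ambient R) :=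
  (StarAlgebra.adjoin ℂ {ambX R, ambY R}).topologicalClosure

/-- The universal unital C*-algebra generated by two contractions subject to `R`. (A C*-algebra
generated by two elements is separable, hence has a copy in every universe, so the universe of the
models is immaterial.) -/
def Alg : Type (u + 1) := sub R

noncomputable instance : CStarAlgebra (Alg R) :=
  StarSubalgebra.cstarAlgebra (sub R)
    (h_closed := StarSubalgebra.isClosed_topologicalClosure _)

theorem ambX_mem : ambX R ∈ sub R :=
  StarSubalgebra.le_topologicalClosure _ (StarAlgebra.subset_adjoin ℂ _ (by simp))

theorem ambY_mem : ambY R ∈ sub R :=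
  StarSubalgebra.le_topologicalClosure _ (StarAlgebra.subset_adjoin ℂ _ (by simp))

/-- The first generator. -/
noncomputable def genX : Alg R := ⟨ambX R, ambX_mem R⟩

/-- The second generator. -/
noncomputable def genY : Alg R := ⟨ambY R, ambY_mem R⟩

variable {R}

/-- Evaluation at a model. -/
noncomputable def eval (m : Model R) : Alg R →⋆ₐ[ℂ] m.carrier where
  toFun a := (a : sub R).1 m
  map_one' := rfl
  map_mul' _ _ := rfl
  map_zero' := rfl
  map_add' _ _ := rfl
  commutes' _ := rfl
  map_star' _ := rfl

theorem alg_ext {a b : Alg R} (h : ∀ m : Model R, eval m a = eval m b) : a = b :=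
  Subtype.ext (lp.ext (funext h))

@[simp] theorem eval_genX (m : Model R) : eval m (genX R) = m.x := rfl

@[simp] theorem eval_genY (m : Model R) : eval m (genY R) = m.y := rfl

/-- The universal property of `Alg R`. -/
theorem existsUnique_hom {B : Type u} [CStarAlgebra B] {x y : B} (h : R B x y)
    (hx : ‖x‖ ≤ 1) (hy : ‖y‖ ≤ 1) :
    ∃! φ : Alg R →⋆ₐ[ℂ] B, φ (genX R) = x ∧ φ (genY R) = y := by
  rcases subsingleton_or_nontrivial B with hB | hB
  · refine ⟨{ toFun := fun _ => 0, map_one' := Subsingleton.elim _ _,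
              map_mul' := fun _ _ => Subsingleton.elim _ _, map_zero' := rfl,
              map_add' := fun _ _ => Subsingleton.elim _ _,
              commutes' := fun _ => Subsingleton.elim _ _,
              map_star' := fun _ => Subsingleton.elim _ _ },
      ⟨Subsingleton.elim _ _, Subsingleton.elim _ _⟩, fun ψ _ => ?_⟩
    exact StarAlgHom.ext fun _ => Subsingleton.elim _ _
  · refine ⟨eval ⟨B, x, y, h, hx, hy⟩, ⟨rfl, rfl⟩, fun ψ hψ => ?_⟩
    set φ : Alg R →⋆ₐ[ℂ] B := eval ⟨B, x, y, h, hx, hy⟩ with hφ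
    have hφc : Continuous φ :=
      AddMonoidHomClass.continuous_of_bound φ 1 fun a => by
        simpa using NonUnitalStarAlgHom.norm_apply_le φ a
    have hψc : Continuous ψ :=
      AddMonoidHomClass.continuous_of_bound ψ 1 fun a => by
        simpa using NonUnitalStarAlgHom.norm_apply_le ψ a
    refine StarAlgHom.ext_topologicalClosure (φ := ψ) (ψ := φ) hψc hφc ?_
    refine StarAlgHom.ext_adjoin fun z hz => ?_
    obtain ⟨z, hz'⟩ := z
    rcases hz with rfl | rfl
    · exact hψ.1
    · exact hψ.2

theorem norm_le_one_of_isometry {A : Type u} [CStarAlgebra A] {x : A} (h : star x * x = 1) :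
    ‖x‖ ≤ 1 := by
  rcases subsingleton_or_nontrivial A with hA | hA
  · rw [Subsingleton.elim x 0, norm_zero]; exact zero_le_one
  · have h1 := CStarRing.norm_star_mul_self (x := x)
    rw [h, CStarRing.norm_one] at h1
    nlinarith [norm_nonneg x]

end UniversalCStar

/-! ## The 2-adic ring C*-algebra and the Cuntz algebra -/

/-- The defining relations of `Q₂` for a pair `(U, S)`: `U` is unitary, `S` is an isometry,
`S U = U² S` and `S S* + U S S* U* = 1`. -/
structure TwoAdicRelations (A : Type u) [CStarAlgebra A] (U S : A) : Prop where
  star_U_mul : star U * U = 1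
  U_mul_star : U * star U = 1
  isometry : star S * S = 1
  comm : S * U = U ^ 2 * S
  sum : S * star S + U * S * star S * star U = 1

/-- The defining relations of `O₂`: two isometries whose range projections add up to `1`. -/
structure CuntzRelations (A : Type u) [CStarAlgebra A] (X₁ X₂ : A) : Prop where
  isometry₁ : star X₁ * X₁ = 1
  isometry₂ : star X₂ * X₂ = 1
  sum : X₁ * star X₁ + X₂ * star X₂ = 1

/-- The isometry `S` is automatically proper. -/
theorem TwoAdicRelations.proper {A : Type u} [CStarAlgebra A] [Nontrivial A] {U S : A}
    (h : TwoAdicRelations A U S) : S * star S ≠ 1 := by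
  intro h1
  have h2 := h.sum
  rw [mul_assoc U S, h1, mul_one, h.U_mul_star] at h2
  exact one_ne_zero (add_eq_left.mp h2)

/-- The 2-adic ring C*-algebra `Q₂`. -/
abbrev TwoAdicRingAlgebra : Type (u + 1) := UniversalCStar.Alg.{u} TwoAdicRelations

/-- The Cuntz algebra `O₂`. -/
abbrev CuntzAlgebra : Type (u + 1) := UniversalCStar.Alg.{u} CuntzRelations

namespace TwoAdicRingAlgebra

/-- The unitary generator `U` of `Q₂`. -/
noncomputable def U : TwoAdicRingAlgebra.{u} := UniversalCStar.genX TwoAdicRelations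

/-- The isometric generator `S₂` of `Q₂`. -/
noncomputable def S₂ : TwoAdicRingAlgebra.{u} := UniversalCStar.genY TwoAdicRelations

theorem relations : TwoAdicRelations TwoAdicRingAlgebra.{u} U S₂ where
  star_U_mul := UniversalCStar.alg_ext fun m => by simpa [U, map_star] using m.rel.star_U_mul
  U_mul_star := UniversalCStar.alg_ext fun m => by simpa [U, map_star] using m.rel.U_mul_star
  isometry := UniversalCStar.alg_ext fun m => by simpa [S₂, map_star] using m.rel.isometry
  comm := UniversalCStar.alg_ext fun m => by simpa [U, S₂, map_star] using m.rel.comm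
  sum := UniversalCStar.alg_ext fun m => by simpa [U, S₂, map_star] using m.rel.sum

/-- The universal property of `Q₂`. -/
theorem existsUnique_hom {B : Type u} [CStarAlgebra B] {V T : B} (h : TwoAdicRelations B V T) :
    ∃! φ : TwoAdicRingAlgebra.{u} →⋆ₐ[ℂ] B, φ U = V ∧ φ S₂ = T :=
  UniversalCStar.existsUnique_hom h
    (UniversalCStar.norm_le_one_of_isometry h.star_U_mul)
    (UniversalCStar.norm_le_one_of_isometry h.isometry)

end TwoAdicRingAlgebra

namespace CuntzAlgebra

/-- The first generating isometry of `O₂`. -/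
noncomputable def X₁ : CuntzAlgebra.{u} := UniversalCStar.genX CuntzRelations

/-- The second generating isometry of `O₂`. -/
noncomputable def X₂ : CuntzAlgebra.{u} := UniversalCStar.genY CuntzRelations

theorem relations : CuntzRelations CuntzAlgebra.{u} X₁ X₂ where
  isometry₁ := UniversalCStar.alg_ext fun m => by simpa [X₁, map_star] using m.rel.isometry₁
  isometry₂ := UniversalCStar.alg_ext fun m => by simpa [X₂, map_star] using m.rel.isometry₂
  sum := UniversalCStar.alg_ext fun m => by simpa [X₁, X₂, map_star] using m.rel.sum

/-- The universal property of `O₂`. -/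
theorem existsUnique_hom {B : Type u} [CStarAlgebra B] {Y₁ Y₂ : B} (h : CuntzRelations B Y₁ Y₂) :
    ∃! φ : CuntzAlgebra.{u} →⋆ₐ[ℂ] B, φ X₁ = Y₁ ∧ φ X₂ = Y₂ :=
  UniversalCStar.existsUnique_hom h
    (UniversalCStar.norm_le_one_of_isometry h.isometry₁)
    (UniversalCStar.norm_le_one_of_isometry h.isometry₂)

theorem relations_in_twoAdic :
    CuntzRelations TwoAdicRingAlgebra.{u}
      (TwoAdicRingAlgebra.U * TwoAdicRingAlgebra.S₂) TwoAdicRingAlgebra.S₂ where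
  isometry₁ := by
    have h := TwoAdicRingAlgebra.relations.{u}
    rw [star_mul, mul_assoc, ← mul_assoc (star TwoAdicRingAlgebra.U), h.star_U_mul, one_mul,
      h.isometry]
  isometry₂ := TwoAdicRingAlgebra.relations.isometry
  sum := by
    have h := TwoAdicRingAlgebra.relations.{u}
    rw [star_mul, ← mul_assoc, add_comm]
    exact h.sum

/-- The inclusion `O₂ ⊂ Q₂`, sending `X₁` to `U S₂` and `X₂` to `S₂`. (The universe of the models
of `O₂` is raised by one so that `Q₂` itself is among them.) -/
noncomputable def toTwoAdic : CuntzAlgebra.{u + 1} →⋆ₐ[ℂ] TwoAdicRingAlgebra.{u} :=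
  (existsUnique_hom relations_in_twoAdic).choose

theorem toTwoAdic_X₁ :
    toTwoAdic.{u} X₁ = TwoAdicRingAlgebra.U * TwoAdicRingAlgebra.S₂ :=
  (existsUnique_hom relations_in_twoAdic).choose_spec.1.1

theorem toTwoAdic_X₂ : toTwoAdic.{u} X₂ = TwoAdicRingAlgebra.S₂ :=
  (existsUnique_hom relations_in_twoAdic).choose_spec.1.2

end CuntzAlgebra

/-! ## Representations on Hilbert spaces -/

namespace Rep

section

variable {A : Type u} [CStarAlgebra A]
  {H : Type v} [NormedAddCommGroup H] [InnerProductSpace ℂ H] [CompleteSpace H]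
  {K : Type w} [NormedAddCommGroup K] [InnerProductSpace ℂ K] [CompleteSpace K]

/-- The subspace `M` is invariant under the representation `ρ`. -/
def IsInvariant (ρ : A →⋆ₐ[ℂ] (H →L[ℂ] H)) (M : Submodule ℂ H) : Prop :=
  ∀ a : A, ∀ x ∈ M, ρ a x ∈ M

/-- The restriction of a representation to a closed invariant subspace. -/
noncomputable def subrep (ρ : A →⋆ₐ[ℂ] (H →L[ℂ] H)) (M : Submodule ℂ H) [CompleteSpace M]
    (hM : IsInvariant ρ M) : A →⋆ₐ[ℂ] (M →L[ℂ] M) where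
  toFun a := ((ρ a).comp M.subtypeL).codRestrict M fun x => hM a x x.2
  map_one' := by ext x; simp
  map_mul' a b := by
    ext x
    change ρ (a * b) x = ρ a (ρ b x)
    rw [map_mul]; rfl
  map_zero' := by ext x; simp
  map_add' a b := by
    ext x
    change ρ (a + b) x = ρ a x + ρ b x
    rw [map_add]; rfl
  commutes' r := by ext x; simp [Algebra.algebraMap_eq_smul_one]
  map_star' a := by
    rw [ContinuousLinearMap.star_eq_adjoint, ContinuousLinearMap.eq_adjoint_iff]
    intro x y
    change inner ℂ (ρ (star a) x) (y : H) = inner ℂ (x : H) (ρ a y)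
    rw [map_star, ContinuousLinearMap.star_eq_adjoint, ContinuousLinearMap.adjoint_inner_left]

/-- A representation is irreducible if the space is nonzero and the only closed invariant
subspaces are trivial. -/
def IsIrreducible (ρ : A →⋆ₐ[ℂ] (H →L[ℂ] H)) : Prop :=
  Nontrivial H ∧ ∀ M : Submodule ℂ H, IsClosed (M : Set H) → IsInvariant ρ M → M = ⊥ ∨ M = ⊤

/-- Unitary equivalence of representations. -/
def UnitarilyEquivalent (ρ : A →⋆ₐ[ℂ] (H →L[ℂ] H)) (ρ' : A →⋆ₐ[ℂ] (K →L[ℂ] K)) : Prop :=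
  ∃ V : H ≃ₗᵢ[ℂ] K, ∀ (a : A) (x : H), V (ρ a x) = ρ' a (V x)

/-- The closed linear span of the basis vectors with index in `I`. -/
noncomputable def basisSpan (b : HilbertBasis ℕ ℂ H) (I : Set ℕ) : Submodule ℂ H :=
  (Submodule.span ℂ (b '' I)).topologicalClosure

instance (b : HilbertBasis ℕ ℂ H) (I : Set ℕ) : CompleteSpace (basisSpan b I) :=
  inferInstanceAs (CompleteSpace (Submodule.span ℂ (b '' I)).topologicalClosure)

/-- `ρ` is the Hilbert space direct sum of irreducible subrepresentations, the `j`-th one acting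
on the closed span of the basis vectors with index in `I j`. -/
structure IsIrreducibleDecomposition (ρ : A →⋆ₐ[ℂ] (H →L[ℂ] H)) (b : HilbertBasis ℕ ℂ H)
    {J : Type} (I : J → Set ℕ) : Prop where
  invariant : ∀ j, IsInvariant ρ (basisSpan b (I j))
  irreducible : ∀ j, IsIrreducible (subrep ρ (basisSpan b (I j)) (invariant j))
  hilbertSum : IsHilbertSum ℂ (fun j => basisSpan b (I j))
    (fun j => (basisSpan b (I j)).subtypeₗᵢ)

/-- `ρ` decomposes into a direct sum of irreducible permutative subrepresentations. -/
def DecomposesIntoIrreducibles (ρ : A →⋆ₐ[ℂ] (H →L[ℂ] H)) (b : HilbertBasis ℕ ℂ H) : Prop :=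
  ∃ (J : Type) (I : J → Set ℕ), IsIrreducibleDecomposition ρ b I

/-- `ρ` decomposes into a direct sum of pairwise inequivalent irreducible permutative
subrepresentations. -/
def DecomposesIntoDistinctIrreducibles (ρ : A →⋆ₐ[ℂ] (H →L[ℂ] H)) (b : HilbertBasis ℕ ℂ H) :
    Prop :=
  ∃ (J : Type) (I : J → Set ℕ) (h : IsIrreducibleDecomposition ρ b I),
    ∀ j k : J, j ≠ k → ¬ UnitarilyEquivalent
      (subrep ρ (basisSpan b (I j)) (h.invariant j)) (subrep ρ (basisSpan b (I k)) (h.invariant k))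

end

end Rep

/-! ## Branching function systems and the coding map -/

/-- A branching function system of order 2. The letters `1, 2` are written `0, 1 : Fin 2`. -/
structure BranchingSystem where
  map : Fin 2 → ℕ → ℕ
  injective : ∀ i, Function.Injective (map i)
  disjoint : Disjoint (Set.range (map 0)) (Set.range (map 1))
  cover : Set.range (map 0) ∪ Set.range (map 1) = Set.univ

namespace BranchingSystem

variable (σ : BranchingSystem)

/-- `σ.word [i₁, …, iₖ] = σ_{i₁} ∘ ⋯ ∘ σ_{iₖ}`. -/
def word (l : List (Fin 2)) (n : ℕ) : ℕ := l.foldr σ.map n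

theorem map_eq_map {i j : Fin 2} {m n : ℕ} (h : σ.map i m = σ.map j n) : i = j ∧ m = n := by
  have hd := Set.disjoint_left.mp σ.disjoint
  have hij : i = j := by
    fin_cases i <;> fin_cases j
    · rfl
    · exact absurd ⟨n, h.symm⟩ (hd ⟨m, rfl⟩)
    · exact absurd ⟨m, h⟩ (hd ⟨n, rfl⟩)
    · rfl
  subst hij
  exact ⟨rfl, σ.injective i h⟩

theorem exists_map_eq (n : ℕ) : ∃ p : Fin 2 × ℕ, σ.map p.1 p.2 = n := by
  have h : n ∈ Set.range (σ.map 0) ∪ Set.range (σ.map 1) := by rw [σ.cover]; trivial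
  rcases h with ⟨m, hm⟩ | ⟨m, hm⟩
  · exact ⟨(0, m), hm⟩
  · exact ⟨(1, m), hm⟩

theorem word_eq_word {l l' : List (Fin 2)} (hl : l.length = l'.length) {m n : ℕ}
    (h : σ.word l m = σ.word l' n) : l = l' := by
  induction l generalizing l' with
  | nil => exact (List.length_eq_zero_iff.mp hl.symm).symm
  | cons i l ih =>
    cases l' with
    | nil => simp at hl
    | cons j l' =>
      obtain ⟨h1, h2⟩ := σ.map_eq_map (i := i) (j := j) h
      rw [h1, ih (by simpa using hl) h2]

/-- There is exactly one sequence `(i₁, i₂, …)` such that `n` lies in the range of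
`σ_{i₁} ∘ ⋯ ∘ σ_{iₖ}` for all `k`. -/
theorem existsUnique_code (n : ℕ) :
    ∃! s : ℕ → Fin 2, ∀ k : ℕ, n ∈ Set.range (σ.word (List.ofFn fun j : Fin k => s j)) := by
  choose step hstep using σ.exists_map_eq
  let s : ℕ → ℕ → Fin 2 := fun n k => (step ((fun m => (step m).2)^[k] n)).1
  have key : ∀ k n, σ.word (List.ofFn fun j : Fin k => s n j) ((fun m => (step m).2)^[k] n) = n := by
    intro k
    induction k with
    | zero => intro n; simp [word]
    | succ k ih =>
      intro n
      have h1 := ih (step n).2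
      rw [List.ofFn_succ]
      change σ.map (step n).1 (σ.word (List.ofFn fun j : Fin k => s (step n).2 j)
        ((fun m => (step m).2)^[k] (step n).2)) = n
      rw [h1, hstep]
  refine ⟨s n, fun k => ⟨_, key k n⟩, fun t ht => funext fun k => ?_⟩
  obtain ⟨m, hm⟩ := ht (k + 1)
  have h2 := σ.word_eq_word (by simp) (hm.trans (key (k + 1) n).symm)
  have h3 := congrFun (List.ofFn_injective h2) (Fin.last k)
  simpa using h3

/-- The coding map. -/
noncomputable def coding (n : ℕ) : ℕ → Fin 2 := (σ.existsUnique_code n).choose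

/-- If `n` and `σ_{i₁} ∘ ⋯ ∘ σ_{iₖ} (n)` have the same code, then they are equal. -/
def CodingPartiallyInjective : Prop :=
  ∀ (n : ℕ) (l : List (Fin 2)), σ.coding n = σ.coding (σ.word l n) → n = σ.word l n

end BranchingSystem

/-! ## Permutative representations -/

section

variable {H : Type v} [NormedAddCommGroup H] [InnerProductSpace ℂ H] [CompleteSpace H]

/-- A representation of `Q₂` is permutative with respect to the orthonormal basis `b`. -/
def TwoAdicRingAlgebra.IsPermutative (ρ : TwoAdicRingAlgebra.{u} →⋆ₐ[ℂ] (H →L[ℂ] H))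
    (b : HilbertBasis ℕ ℂ H) : Prop :=
  ∃ (σ₂ : ℕ → ℕ) (τ : Equiv.Perm ℕ), Function.Injective σ₂ ∧
    ∀ n, ρ TwoAdicRingAlgebra.S₂ (b n) = b (σ₂ n) ∧ ρ TwoAdicRingAlgebra.U (b n) = b (τ n)

namespace CuntzAlgebra

/-- The representation `π` of `O₂` is permutative with respect to the orthonormal basis `b`, with
branching function system `σ`. -/
def IsImplementedBy (π : CuntzAlgebra.{u} →⋆ₐ[ℂ] (H →L[ℂ] H)) (b : HilbertBasis ℕ ℂ H)
    (σ : BranchingSystem) : Prop :=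
  ∀ n, π X₁ (b n) = b (σ.map 0 n) ∧ π X₂ (b n) = b (σ.map 1 n)

/-- Regularity in the sense of Bratteli and Jorgensen. -/
def IsRegular (π : CuntzAlgebra.{u} →⋆ₐ[ℂ] (H →L[ℂ] H)) (b : HilbertBasis ℕ ℂ H) : Prop :=
  ∃ σ : BranchingSystem, IsImplementedBy π b σ ∧ σ.CodingPartiallyInjective

/-- Multiplicity-freeness in the sense of Bratteli and Jorgensen. -/
def IsMultiplicityFree (π : CuntzAlgebra.{u} →⋆ₐ[ℂ] (H →L[ℂ] H)) (b : HilbertBasis ℕ ℂ H) : Prop :=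
  ∃ σ : BranchingSystem, IsImplementedBy π b σ ∧ Function.Injective σ.coding

/-- The restriction to `O₂` of a representation of `Q₂`. -/
noncomputable def restrict (ρ : TwoAdicRingAlgebra.{u} →⋆ₐ[ℂ] (H →L[ℂ] H)) :
    CuntzAlgebra.{u + 1} →⋆ₐ[ℂ] (H →L[ℂ] H) :=
  ρ.comp toTwoAdic

end CuntzAlgebra

end

/-! The code of an index `n` amounts to a 2-adic integer z(n), recorded by its residues mod 2^k. On
these numbers `τ` acts as z ↦ z + 1 and `σ` as z ↦ 2z. An invariant set of indices is a union of
orbits of the relation generated by `τ` and `σ`, and the summands in the theorem come from these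
orbits.

If codes are injective on an orbit, its span is irreducible. The range projections along the code of
`n` fix `b n`, and a vector of the span fixed by all of them is a multiple of `b n`. Hence a closed
invariant subspace contains `b n` or is orthogonal to it (`Implements.isIrreducible`). The same
projections separate orbits with different codes (`Implements.not_unitarilyEquivalent`). Regularity
is equivalent to this injectivity on orbits, although it only tests pairs related by a word
(`eq_of_same_of_connected`).

Conversely, coincidences of codes produce symmetries. If `n` and a word applied to `n` share a code,
some permutation commuting with `σ` and `τ` takes one to the other (`exists_commutes_of_same`). By
Schur's lemma, irreducibility forbids it from moving `n` within a summand. If two different summands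
share a code, minimality makes their sets of codes equal, and matching indices with equal codes
gives a unitary equivalence (`exists_commutes_swap`). -/

/-- An injection `σ` and a bijection `τ` of `ℕ` satisfying the relations of `Q₂`. -/
structure TwoAdicSystem where
  σ : ℕ → ℕ
  τ : Equiv.Perm ℕ
  inj : Function.Injective σ
  comm : ∀ n, σ (τ n) = τ (τ (σ n))
  disjoint : ∀ m n, σ m ≠ τ (σ n)
  cover : ∀ n, (∃ m, n = σ m) ∨ ∃ m, n = τ (σ m)

/-! ### The action of `τ` and `σ` on 2-adic residues -/

namespace TwoAdicSystem

variable (T : TwoAdicSystem)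

theorem zpow_zpow (a b : ℤ) (n : ℕ) : (T.τ ^ a) ((T.τ ^ b) n) = (T.τ ^ (a + b)) n := by
  rw [zpow_add]; rfl

theorem τ_inv (n : ℕ) : T.τ (T.τ⁻¹ n) = n := T.τ.apply_symm_apply n

theorem τ_zpow (a : ℤ) (n : ℕ) : T.τ ((T.τ ^ a) n) = (T.τ ^ (1 + a)) n := by
  rw [zpow_one_add]; rfl

theorem σ_zpow (a : ℤ) (n : ℕ) : T.σ ((T.τ ^ a) n) = (T.τ ^ (2 * a)) (T.σ n) := by
  have key : ∀ n, T.σ (T.τ⁻¹ n) = (T.τ ^ (-2 : ℤ)) (T.σ n) := by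
    intro n
    have h := T.comm (T.τ⁻¹ n)
    rw [τ_inv] at h
    apply T.τ.injective
    apply T.τ.injective
    rw [← h, τ_zpow, τ_zpow]
    simp
  induction a using Int.induction_on generalizing n with
  | zero => simp
  | succ i ih =>
    rw [zpow_add, Equiv.Perm.mul_apply, ih, zpow_one, T.comm, mul_add, zpow_add]
    rfl
  | pred i ih =>
    rw [sub_eq_add_neg, zpow_add, Equiv.Perm.mul_apply, ih, zpow_neg_one, key, zpow_zpow]
    congr 2; ring

theorem iterate_zpow (k : ℕ) (a : ℤ) (n : ℕ) :
    T.σ^[k] ((T.τ ^ a) n) = (T.τ ^ (2 ^ k * a)) (T.σ^[k] n) := by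
  induction k generalizing a n with
  | zero => simp
  | succ k ih =>
    rw [Function.iterate_succ_apply, σ_zpow, ih, Function.iterate_succ_apply, pow_succ, mul_assoc]

theorem iterate_τ (k : ℕ) (n : ℕ) : T.σ^[k] (T.τ n) = (T.τ ^ (2 ^ k : ℤ)) (T.σ^[k] n) := by
  simpa using T.iterate_zpow k 1 n

theorem iterate_inj (k : ℕ) : Function.Injective T.σ^[k] := T.inj.iterate k

/-- Both sides have a code divisible by 2^k, and `τ ^ a` shifts codes by `a`. The ranges of `σ` and
`τ ∘ σ` are disjoint, so `a` is even; halve it and cancel one `σ`. -/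
theorem two_pow_dvd {k : ℕ} {a : ℤ} {m n : ℕ} (h : (T.τ ^ a) (T.σ^[k] m) = T.σ^[k] n) :
    (2 : ℤ) ^ k ∣ a := by
  induction k generalizing a with
  | zero => simp
  | succ k ih =>
    rw [Function.iterate_succ_apply', Function.iterate_succ_apply'] at h
    rcases Int.even_or_odd' a with ⟨e, rfl | rfl⟩
    · rw [← σ_zpow] at h
      rw [pow_succ']
      exact mul_dvd_mul_left 2 (ih (T.inj h))
    · rw [add_comm, zpow_add, Equiv.Perm.mul_apply, ← σ_zpow, zpow_one] at h
      exact absurd h.symm (T.disjoint _ _)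

/-- The 2-adic integer attached to `n` is congruent to `r` modulo `2 ^ k`. -/
def Res (k : ℕ) (n : ℕ) (r : ℤ) : Prop := ∃ m, n = (T.τ ^ r) (T.σ^[k] m)

variable {T}

theorem exists_res (k n : ℕ) : ∃ r, T.Res k n r := by
  induction k with
  | zero => exact ⟨0, n, by simp⟩
  | succ k ih =>
    obtain ⟨r, m, rfl⟩ := ih
    rcases T.cover m with ⟨m, rfl⟩ | ⟨m, rfl⟩
    · exact ⟨r, m, by rw [Function.iterate_succ_apply]⟩
    · refine ⟨r + 2 ^ k, m, ?_⟩
      rw [Function.iterate_succ_apply, iterate_τ, zpow_zpow]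

theorem Res.iff_dvd {k n : ℕ} {r s : ℤ} (h : T.Res k n r) : T.Res k n s ↔ (2 : ℤ) ^ k ∣ r - s := by
  obtain ⟨m, rfl⟩ := h
  constructor
  · rintro ⟨m', h⟩
    refine T.two_pow_dvd (m := m) (n := m') ?_
    rw [sub_eq_neg_add, ← zpow_zpow, h, zpow_zpow]
    simp
  · rintro ⟨c, hc⟩
    refine ⟨(T.τ ^ c) m, ?_⟩
    rw [iterate_zpow, zpow_zpow, ← hc]
    simp

theorem Res.zpow {k n : ℕ} {r : ℤ} (h : T.Res k n r) (a : ℤ) : T.Res k ((T.τ ^ a) n) (a + r) := by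
  obtain ⟨m, rfl⟩ := h
  exact ⟨m, zpow_zpow T a r _⟩

theorem Res.σ {k n : ℕ} {r : ℤ} (h : T.Res k n r) : T.Res (k + 1) (T.σ n) (2 * r) := by
  obtain ⟨m, rfl⟩ := h
  exact ⟨m, by rw [σ_zpow, Function.iterate_succ_apply']⟩

theorem Res.of_σ {k n : ℕ} {r : ℤ} (h : T.Res (k + 1) (T.σ n) (2 * r)) : T.Res k n r := by
  obtain ⟨m, h⟩ := h
  rw [Function.iterate_succ_apply', ← σ_zpow] at h
  exact ⟨m, T.inj h⟩

theorem Res.of_succ {k n : ℕ} {r : ℤ} (h : T.Res (k + 1) n r) : T.Res k n r := by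
  obtain ⟨m, rfl⟩ := h
  exact ⟨T.σ m, by rw [Function.iterate_succ_apply]⟩

variable (T) in
/-- The 2-adic integers attached to `m` and `n` agree. -/
def Same (m n : ℕ) : Prop := ∀ k r, T.Res k m r ↔ T.Res k n r

/-- One common residue per level suffices, because a residue determines its whole class mod 2^k. -/
theorem same_of_res {m n : ℕ} (h : ∀ k, ∃ r, T.Res k m r ∧ T.Res k n r) : T.Same m n := by
  intro k s
  obtain ⟨r, h1, h2⟩ := h k
  rw [h1.iff_dvd, h2.iff_dvd]

theorem Same.refl (n : ℕ) : T.Same n n := fun _ _ => Iff.rfl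

theorem Same.symm {m n : ℕ} (h : T.Same m n) : T.Same n m := fun k r => (h k r).symm

theorem Same.trans {l m n : ℕ} (h : T.Same l m) (h' : T.Same m n) : T.Same l n :=
  fun k r => (h k r).trans (h' k r)

theorem Same.zpow {m n : ℕ} (h : T.Same m n) (a : ℤ) : T.Same ((T.τ ^ a) m) ((T.τ ^ a) n) := by
  refine same_of_res fun k => ?_
  obtain ⟨r, hr⟩ := exists_res (T := T) k m
  exact ⟨a + r, hr.zpow a, ((h k r).mp hr).zpow a⟩

theorem Same.τ {m n : ℕ} (h : T.Same m n) : T.Same (T.τ m) (T.τ n) := by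
  simpa using h.zpow 1

theorem Same.of_zpow {m n : ℕ} {a : ℤ} (h : T.Same ((T.τ ^ a) m) ((T.τ ^ a) n)) : T.Same m n := by
  have := h.zpow (-a)
  simpa [zpow_zpow] using this

theorem Same.of_τ {m n : ℕ} (h : T.Same (T.τ m) (T.τ n)) : T.Same m n :=
  Same.of_zpow (a := 1) (by simpa using h)

theorem Same.σ {m n : ℕ} (h : T.Same m n) : T.Same (T.σ m) (T.σ n) := by
  refine same_of_res fun k => ?_
  obtain ⟨r, hr⟩ := exists_res (T := T) k m
  exact ⟨2 * r, hr.σ.of_succ, ((h k r).mp hr).σ.of_succ⟩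

theorem Same.of_σ {m n : ℕ} (h : T.Same (T.σ m) (T.σ n)) : T.Same m n := by
  refine same_of_res fun k => ?_
  obtain ⟨r, hr⟩ := exists_res (T := T) k m
  exact ⟨r, hr, ((h _ _).mp hr.σ).of_σ⟩

theorem Same.iterate {m n : ℕ} (h : T.Same m n) (k : ℕ) : T.Same (T.σ^[k] m) (T.σ^[k] n) := by
  induction k with
  | zero => exact h
  | succ k ih => simpa only [Function.iterate_succ_apply'] using ih.σ

theorem Same.of_iterate {m n : ℕ} {k : ℕ} (h : T.Same (T.σ^[k] m) (T.σ^[k] n)) : T.Same m n := by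
  induction k with
  | zero => exact h
  | succ k ih =>
    simp only [Function.iterate_succ_apply'] at h
    exact ih h.of_σ

/-- Translation by a nonzero integer has no fixed point in the 2-adic integers: `a` would be
divisible by every 2^k, which fails already for k = |a|. -/
theorem Same.eq_zero {n : ℕ} {a : ℤ} (h : T.Same n ((T.τ ^ a) n)) : a = 0 := by
  have key : ∀ k : ℕ, (2 : ℤ) ^ k ∣ a := by
    intro k
    obtain ⟨r, hr⟩ := exists_res (T := T) k n
    have := hr.iff_dvd.mp ((h k _).mpr (hr.zpow a))
    simpa using this
  by_contra ha
  have h1 := Int.natAbs_dvd_natAbs.mpr (key a.natAbs)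
  have h2 := Nat.le_of_dvd (Int.natAbs_pos.mpr ha) h1
  rw [Int.natAbs_pow] at h2
  exact absurd h2 (not_le.mpr (Nat.lt_two_pow_self))

theorem Same.zpow_inj {n : ℕ} {a b : ℤ} (h : T.Same ((T.τ ^ a) n) ((T.τ ^ b) n)) : a = b := by
  have h1 := h.zpow (-a)
  rw [zpow_zpow, zpow_zpow, neg_add_cancel, zpow_zero] at h1
  have := Same.eq_zero h1
  omega

/-- The range of `σ^[k]` consists of the indices with residue 0 mod 2^k, so the code alone detects
it. -/
theorem Same.exists_eq_iterate {m n k : ℕ} (h : T.Same (T.σ^[k] m) n) : ∃ n', n = T.σ^[k] n' := by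
  obtain ⟨n', hn⟩ := (h k 0).mp ⟨m, by simp⟩
  exact ⟨n', by simpa using hn⟩

theorem Same.exists_eq_σ {m n : ℕ} (h : T.Same (T.σ m) n) : ∃ n', n = T.σ n' :=
  Same.exists_eq_iterate (k := 1) h

/-! ### Invariant sets and orbits -/

variable (T) in
/-- A set of indices spanning a reducing subspace. -/
structure Invariant (I : Set ℕ) : Prop where
  τ_mem : ∀ n, T.τ n ∈ I ↔ n ∈ I
  σ_mem : ∀ n, T.σ n ∈ I ↔ n ∈ I

theorem Invariant.zpow_mem {I : Set ℕ} (h : T.Invariant I) (a : ℤ) (n : ℕ) :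
    (T.τ ^ a) n ∈ I ↔ n ∈ I := by
  induction a using Int.induction_on generalizing n with
  | zero => simp
  | succ i ih => rw [zpow_add, Equiv.Perm.mul_apply, ih, zpow_one, h.τ_mem]
  | pred i ih =>
    rw [sub_eq_add_neg, zpow_add, Equiv.Perm.mul_apply, ih, zpow_neg_one, ← h.τ_mem,
      τ_inv]

theorem Invariant.iterate_mem {I : Set ℕ} (h : T.Invariant I) (k : ℕ) (n : ℕ) :
    T.σ^[k] n ∈ I ↔ n ∈ I := by
  induction k with
  | zero => rfl
  | succ k ih => rw [Function.iterate_succ_apply', h.σ_mem, ih]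

variable (T) in
/-- `m` and `n` lie in the same orbit. -/
def Connected (m n : ℕ) : Prop := ∃ (p q : ℕ) (a : ℤ), T.σ^[p] n = (T.τ ^ a) (T.σ^[q] m)

theorem Connected.symm {m n : ℕ} (h : T.Connected m n) : T.Connected n m := by
  obtain ⟨p, q, a, h⟩ := h
  exact ⟨q, p, -a, by rw [h, zpow_zpow]; simp⟩

theorem Connected.trans {l m n : ℕ} (h : T.Connected l m) (h' : T.Connected m n) :
    T.Connected l n := by
  obtain ⟨p, q, a, h⟩ := h
  obtain ⟨p', q', a', h'⟩ := h'
  refine ⟨p + p', q' + q, 2 ^ p * a' + 2 ^ q' * a, ?_⟩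
  rw [Function.iterate_add_apply, h', iterate_zpow, ← Function.iterate_add_apply, add_comm p,
    Function.iterate_add_apply, h, iterate_zpow, zpow_zpow, ← Function.iterate_add_apply]

theorem connected_τ (n : ℕ) : T.Connected n (T.τ n) := ⟨0, 0, 1, by simp⟩

theorem connected_σ (n : ℕ) : T.Connected n (T.σ n) := ⟨0, 1, 0, by simp⟩

variable (T) in
/-- The orbit relation. -/
def orbitSetoid : Setoid ℕ where
  r := T.Connected
  iseqv := ⟨fun _ => ⟨0, 0, 0, by simp⟩, Connected.symm, Connected.trans⟩

theorem invariant_connected (m : ℕ) : T.Invariant {n | T.Connected m n} where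
  τ_mem n := ⟨fun h => h.trans (connected_τ n).symm, fun h => h.trans (connected_τ n)⟩
  σ_mem n := ⟨fun h => h.trans (connected_σ n).symm, fun h => h.trans (connected_σ n)⟩

theorem Invariant.mem_of_connected {I : Set ℕ} (h : T.Invariant I) {m n : ℕ}
    (hc : T.Connected m n) (hm : m ∈ I) : n ∈ I := by
  obtain ⟨p, q, a, hc⟩ := hc
  rw [← h.iterate_mem p, hc, h.zpow_mem, h.iterate_mem]
  exact hm

/-- The smaller power of `σ` can be cancelled from both sides, since by `two_pow_dvd` the
translation exponent is divisible by the matching power of 2. -/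
theorem Connected.exists_eq {m n : ℕ} (h : T.Connected m n) :
    ∃ (q : ℕ) (a : ℤ), n = (T.τ ^ a) (T.σ^[q] m) ∨ m = (T.τ ^ a) (T.σ^[q] n) := by
  have key : ∀ {m n p q : ℕ} {a : ℤ}, p ≤ q → T.σ^[p] n = (T.τ ^ a) (T.σ^[q] m) →
      ∃ (q : ℕ) (a : ℤ), n = (T.τ ^ a) (T.σ^[q] m) := by
    intro m n p q a hpq h
    obtain ⟨d, rfl⟩ := Nat.exists_eq_add_of_le hpq
    rw [Function.iterate_add_apply] at h
    obtain ⟨c, rfl⟩ := T.two_pow_dvd h.symm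
    rw [← iterate_zpow] at h
    exact ⟨d, c, T.iterate_inj p h⟩
  obtain ⟨p, q, a, h⟩ := h
  rcases le_total p q with hpq | hpq
  · obtain ⟨q, a, h⟩ := key hpq h
    exact ⟨q, a, Or.inl h⟩
  · obtain ⟨q, a, h⟩ := key (m := n) (n := m) hpq (a := -a) (by rw [h, zpow_zpow]; simp)
    exact ⟨q, a, Or.inr h⟩

/-! ### The branching function system -/

variable (T) in
/-- The branching function system `σ₁ = τ ∘ σ`, `σ₂ = σ`. -/
def branching : BranchingSystem where
  map i n := if i = 0 then T.τ (T.σ n) else T.σ n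
  injective i := by
    fin_cases i
    · exact T.τ.injective.comp T.inj
    · exact T.inj
  disjoint := by
    rw [Set.disjoint_left]
    rintro _ ⟨m, rfl⟩ ⟨n, h⟩
    exact T.disjoint n m (by simpa using h)
  cover := by
    rw [Set.eq_univ_iff_forall]
    intro n
    rcases T.cover n with ⟨m, rfl⟩ | ⟨m, rfl⟩
    · exact Or.inr ⟨m, by simp⟩
    · exact Or.inl ⟨m, by simp⟩

theorem word_eq (l : List (Fin 2)) :
    ∃ r : ℤ, ∀ n, T.branching.word l n = (T.τ ^ r) (T.σ^[l.length] n) := by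
  induction l with
  | nil => exact ⟨0, fun n => by simp [BranchingSystem.word]⟩
  | cons i l ih =>
    obtain ⟨r, h⟩ := ih
    have h' : ∀ n, T.branching.word (i :: l) n = T.branching.map i (T.branching.word l n) :=
      fun _ => rfl
    fin_cases i
    · refine ⟨1 + 2 * r, fun n => ?_⟩
      rw [h', h, List.length_cons, Function.iterate_succ_apply', ← zpow_zpow, ← σ_zpow]
      simp [branching]
    · refine ⟨2 * r, fun n => ?_⟩
      rw [h', h, List.length_cons, Function.iterate_succ_apply', ← σ_zpow]
      simp [branching]

/-- The letters are the binary digits of `r`, lowest first, with letter 0 (that is, `τ ∘ σ`)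
standing for digit 1. -/
theorem exists_word (k : ℕ) (r : ℤ) (h0 : 0 ≤ r) (hr : r < 2 ^ k) :
    ∃ l, ∀ n, T.branching.word l n = (T.τ ^ r) (T.σ^[k] n) := by
  induction k generalizing r with
  | zero =>
    obtain rfl : r = 0 := by simp at hr; omega
    exact ⟨[], fun n => by simp [BranchingSystem.word]⟩
  | succ k ih =>
    rw [pow_succ] at hr
    obtain ⟨l, hl⟩ := ih (r / 2) (by omega) (by omega)
    rcases Int.even_or_odd' r with ⟨e, rfl | rfl⟩
    · have he : 2 * e / 2 = e := by omega
      rw [he] at hl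
      refine ⟨1 :: l, fun n => ?_⟩
      change T.branching.map 1 (T.branching.word l n) = _
      rw [hl, Function.iterate_succ_apply', ← σ_zpow]
      simp [branching]
    · have he : (2 * e + 1) / 2 = e := by omega
      rw [he] at hl
      refine ⟨0 :: l, fun n => ?_⟩
      change T.branching.map 0 (T.branching.word l n) = _
      rw [hl, Function.iterate_succ_apply', add_comm, ← zpow_zpow, ← σ_zpow]
      simp [branching]

/-- A code prefix of length k is the same information as a residue mod 2^k: each prefix word is some
`τ ^ r ∘ σ^[k]`. For the converse, the code of `m` meets the conditions that characterise the code
of `n`. -/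
theorem coding_eq_iff {m n : ℕ} : T.branching.coding m = T.branching.coding n ↔ T.Same m n := by
  have hm := (T.branching.existsUnique_code m).choose_spec.1
  have hn := (T.branching.existsUnique_code n).choose_spec
  constructor
  · intro h
    refine same_of_res fun k => ?_
    have h1 := hm k
    have h2 := hn.1 k
    change m ∈ Set.range (T.branching.word (List.ofFn fun j : Fin k => T.branching.coding m j)) at h1
    change n ∈ Set.range (T.branching.word (List.ofFn fun j : Fin k => T.branching.coding n j)) at h2
    rw [← h] at h2
    obtain ⟨r, hr⟩ := word_eq (T := T) (List.ofFn fun j : Fin k => T.branching.coding m j)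
    obtain ⟨m', h1⟩ := h1
    obtain ⟨n', h2⟩ := h2
    refine ⟨r, ⟨m', ?_⟩, ⟨n', ?_⟩⟩
    · exact h1.symm.trans ((hr m').trans (by simp))
    · exact h2.symm.trans ((hr n').trans (by simp))
  · intro h
    refine hn.2 _ fun k => ?_
    obtain ⟨m', hm'⟩ := hm k
    obtain ⟨r, hr⟩ := word_eq (T := T) (List.ofFn fun j : Fin k => T.branching.coding m j)
    obtain ⟨n', hn'⟩ := (h k r).mp ⟨m', by rw [← hm']; exact (hr m').trans (by simp)⟩
    exact ⟨n', (hr n').trans (by simp [hn'])⟩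

theorem connected_word (l : List (Fin 2)) (n : ℕ) : T.Connected n (T.branching.word l n) := by
  obtain ⟨r, hr⟩ := word_eq (T := T) l
  exact ⟨0, l.length, r, hr n⟩

/-- Regularity only concerns maps `τ ^ r ∘ σ^[q]` with 0 ≤ r < 2^q. Moving both points by a common
power of `τ` brings the general exponent into that range. -/
theorem eq_of_same_of_connected (hreg : T.branching.CodingPartiallyInjective) {m n : ℕ}
    (hc : T.Connected m n) (h : T.Same m n) : m = n := by
  have key : ∀ {m n q : ℕ} {a : ℤ}, T.Same m n → n = (T.τ ^ a) (T.σ^[q] m) → m = n := by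
    intro m n q a h hn
    rcases Nat.eq_zero_or_pos q with rfl | hq
    · simp only [Function.iterate_zero, id_eq] at hn
      rw [hn] at h
      rw [hn, h.eq_zero]; simp
    · have h2 : (1 : ℤ) < 2 ^ q := one_lt_pow₀ (by norm_num) hq.ne'
      -- Conjugating `τ ^ a ∘ σ^[q]` by `τ ^ j` changes the exponent to a - (2^q - 1) j. This `j`
      -- leaves the remainder of a mod 2^q - 1.
      set j := a / (2 ^ q - 1) with hj
      obtain ⟨l, hl⟩ := exists_word (T := T) q (a % (2 ^ q - 1)) (Int.emod_nonneg _ (by omega))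
        ((Int.emod_lt_of_pos a (by omega)).trans (by omega))
      have e : (T.τ ^ j) n = T.branching.word l ((T.τ ^ j) m) := by
        rw [hl, iterate_zpow, zpow_zpow, hn, zpow_zpow]
        congr 2
        have := Int.emod_add_mul_ediv a (2 ^ q - 1)
        rw [← hj] at this
        linarith
      have := hreg ((T.τ ^ j) m) l (by rw [← e]; exact coding_eq_iff.mpr (h.zpow j))
      rw [← e] at this
      exact (T.τ ^ j).injective this
  obtain ⟨q, a, hn | hm⟩ := hc.exists_eq
  · exact key h hn
  · exact (key h.symm hm).symm

/-! ### Permutations commuting with the system -/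

variable (T) in
/-- `θ` commutes with `σ` and `τ`. -/
structure Commutes (θ : Equiv.Perm ℕ) : Prop where
  τ_apply : ∀ n, θ (T.τ n) = T.τ (θ n)
  σ_apply : ∀ n, θ (T.σ n) = T.σ (θ n)

theorem exists_commutes {R : ℕ → ℕ → Prop} (h₁ : ∀ m, ∃! n, R m n) (h₂ : ∀ n, ∃! m, R m n)
    (hτ : ∀ m n, R m n → R (T.τ m) (T.τ n)) (hσ : ∀ m n, R m n → R (T.σ m) (T.σ n)) :
    ∃ θ : Equiv.Perm ℕ, T.Commutes θ ∧ ∀ m n, R m n → θ m = n := by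
  choose f hf hf' using h₁
  choose g hg hg' using h₂
  refine ⟨⟨f, g, fun n => (hg' _ _ (hf n)).symm, fun n => (hf' _ _ (hg n)).symm⟩,
    ⟨fun n => ?_, fun n => ?_⟩, fun m n h => (hf' _ _ h).symm⟩
  · exact (hf' _ _ (hτ _ _ (hf n))).symm
  · exact (hf' _ _ (hσ _ _ (hf n))).symm

/-- The hypothesis says z = 2^q z + a for the code z of `n`. The permutation sends every index `m`
whose code solves such an equation, for some integer a (unique by `Same.zpow_inj`), to `τ ^ a (σ^[q]
m)`, and fixes all others. The exponent depends on `m`. -/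
theorem exists_commutes_of_same {n q : ℕ} {a : ℤ} (h : T.Same n ((T.τ ^ a) (T.σ^[q] n))) :
    ∃ θ, T.Commutes θ ∧ θ n = (T.τ ^ a) (T.σ^[q] n) := by
  let D : ℕ → Prop := fun m => ∃ a : ℤ, T.Same m ((T.τ ^ a) (T.σ^[q] m))
  have Dsame : ∀ {m m'}, T.Same m m' → D m → D m' := fun hs ⟨a, ha⟩ =>
    ⟨a, (hs.symm.trans ha).trans ((hs.iterate q).zpow a)⟩
  have Dτ : ∀ m, D (T.τ m) ↔ D m := by
    have e : ∀ (m : ℕ) (a : ℤ), (T.τ ^ a) (T.σ^[q] (T.τ m)) =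
        T.τ ((T.τ ^ (a + 2 ^ q - 1)) (T.σ^[q] m)) := by
      intro m a
      rw [iterate_τ, zpow_zpow, τ_zpow]
      congr 2; ring
    intro m
    constructor
    · rintro ⟨a, ha⟩
      rw [e] at ha
      exact ⟨_, ha.of_τ⟩
    · rintro ⟨a, ha⟩
      refine ⟨a - 2 ^ q + 1, ?_⟩
      rw [e, show a - 2 ^ q + 1 + 2 ^ q - 1 = a by ring]
      exact ha.τ
  have Dσ : ∀ m, D (T.σ m) ↔ D m := by
    intro m
    constructor
    · rintro ⟨a, ha⟩
      obtain ⟨y, hy⟩ := ha.exists_eq_σ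
      have hy' := hy
      rw [← Function.iterate_succ_apply, Function.iterate_succ_apply'] at hy'
      -- Both sides are divisible by 2, so the shift is even and one `σ` cancels.
      obtain ⟨c, rfl⟩ := T.two_pow_dvd (k := 1) hy'
      rw [pow_one, ← Function.iterate_succ_apply, Function.iterate_succ_apply', ← σ_zpow] at ha
      exact ⟨c, ha.of_σ⟩
    · rintro ⟨a, ha⟩
      refine ⟨2 * a, ?_⟩
      rw [← Function.iterate_succ_apply, Function.iterate_succ_apply', ← σ_zpow]
      exact ha.σ
  let R : ℕ → ℕ → Prop := fun m m' =>
    (T.Same m m' ∧ ∃ a : ℤ, m' = (T.τ ^ a) (T.σ^[q] m)) ∨ (¬ D m ∧ m' = m)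
  have Rsame : ∀ {m m'}, R m m' → T.Same m m' := by
    rintro m m' (h | ⟨_, rfl⟩)
    · exact h.1
    · exact Same.refl _
  have RD : ∀ {m m'}, R m m' → D m' → ∃ a : ℤ, m' = (T.τ ^ a) (T.σ^[q] m) := by
    rintro m m' (h | ⟨h, rfl⟩) hD
    · exact h.2
    · exact absurd hD h
  have RnD : ∀ {m m'}, R m m' → ¬ D m' → m' = m := by
    rintro m m' (⟨h, a, rfl⟩ | ⟨h, rfl⟩) hD
    · exact absurd (Dsame h ⟨a, h⟩) hD
    · rfl
  have R1 : ∀ m, ∃! n, R m n := by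
    intro m
    by_cases hD : D m
    · obtain ⟨a, ha⟩ := hD
      refine ⟨_, Or.inl ⟨ha, a, rfl⟩, fun y hy => ?_⟩
      have hs := Rsame hy
      obtain ⟨c, rfl⟩ := RD hy (Dsame hs ⟨a, ha⟩)
      rw [(hs.symm.trans ha).zpow_inj]
    · exact ⟨m, Or.inr ⟨hD, rfl⟩, fun y hy => RnD hy fun h => hD (Dsame (Rsame hy).symm h)⟩
  have R2 : ∀ n, ∃! m, R m n := by
    intro m
    by_cases hD : D m
    · obtain ⟨a, ha⟩ := hD
      -- Surjectivity on `D`: `τ ^ (-a) m` has the code of `σ^[q] m`, hence lies in the range of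
      -- `σ^[q]`; its preimage is the required point.
      have h1 := ha.symm.zpow (-a)
      rw [zpow_zpow, neg_add_cancel, zpow_zero] at h1
      obtain ⟨m', hm'⟩ := Same.exists_eq_iterate h1
      have hm : m = (T.τ ^ a) (T.σ^[q] m') := by
        rw [← hm', zpow_zpow]; simp
      rw [hm'] at h1
      refine ⟨m', Or.inl ⟨h1.of_iterate.symm, a, hm⟩, fun y hy => ?_⟩
      obtain ⟨c, hc⟩ := RD hy ⟨a, ha⟩
      have hs : T.Same y m' := (Rsame hy).trans h1.of_iterate
      have h2 := (hs.iterate q).zpow c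
      rw [← hc] at h2
      conv at h2 => lhs; rw [hm]
      obtain rfl := h2.zpow_inj
      exact T.iterate_inj q ((T.τ ^ a).injective (hc.symm.trans hm))
    · exact ⟨m, Or.inr ⟨hD, rfl⟩, fun y hy => (RnD hy hD).symm⟩
  have Rτ : ∀ m n, R m n → R (T.τ m) (T.τ n) := by
    rintro m m' (⟨hs, a, rfl⟩ | ⟨hD, rfl⟩)
    · refine Or.inl ⟨hs.τ, a - 2 ^ q + 1, ?_⟩
      rw [iterate_τ, zpow_zpow, τ_zpow]
      congr 2; ring
    · exact Or.inr ⟨fun h => hD ((Dτ _).mp h), rfl⟩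
  have Rσ : ∀ m n, R m n → R (T.σ m) (T.σ n) := by
    rintro m m' (⟨hs, a, rfl⟩ | ⟨hD, rfl⟩)
    · refine Or.inl ⟨hs.σ, 2 * a, ?_⟩
      rw [← Function.iterate_succ_apply, Function.iterate_succ_apply', ← σ_zpow]
    · exact Or.inr ⟨fun h => hD ((Dσ _).mp h), rfl⟩
  obtain ⟨θ, hθ, hR⟩ := exists_commutes (T := T) (R := R) R1 R2 Rτ Rσ
  exact ⟨θ, hθ, hR _ _ (Or.inl ⟨h, a, rfl⟩)⟩

/-- Indices having a companion in `I` with the same code form an invariant set. -/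
theorem Invariant.saturation {I : Set ℕ} (h : T.Invariant I) :
    T.Invariant {m | ∃ n ∈ I, T.Same m n} where
  τ_mem m := by
    constructor
    · rintro ⟨n, hn, hs⟩
      refine ⟨T.τ⁻¹ n, ?_, ?_⟩
      · rwa [← h.τ_mem, τ_inv]
      · apply Same.of_τ
        rwa [τ_inv]
    · rintro ⟨n, hn, hs⟩
      exact ⟨_, (h.τ_mem n).mpr hn, hs.τ⟩
  σ_mem m := by
    constructor
    · rintro ⟨n, hn, hs⟩
      obtain ⟨n, rfl⟩ := hs.exists_eq_σ
      exact ⟨n, (h.σ_mem n).mp hn, hs.of_σ⟩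
    · rintro ⟨n, hn, hs⟩
      exact ⟨_, (h.σ_mem n).mpr hn, hs.σ⟩

/-- Swap each index of `I` with the index of `J` having the same code and fix everything else. -/
theorem exists_commutes_swap {I J : Set ℕ} (hI : T.Invariant I) (hJ : T.Invariant J)
    (hd : Disjoint I J) (hI' : ∀ m ∈ I, ∀ n ∈ I, T.Same m n → m = n)
    (hJ' : ∀ m ∈ J, ∀ n ∈ J, T.Same m n → m = n) (hIJ : ∀ m ∈ I, ∃ n ∈ J, T.Same m n)
    (hJI : ∀ m ∈ J, ∃ n ∈ I, T.Same m n) : ∃ θ, T.Commutes θ ∧ θ '' I = J := by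
  let R : ℕ → ℕ → Prop := fun m n => (m ∈ I ∧ n ∈ J ∧ T.Same m n) ∨ (m ∈ J ∧ n ∈ I ∧ T.Same m n) ∨
    (m ∉ I ∧ m ∉ J ∧ n = m)
  have Rsymm : ∀ {m n}, R m n → R n m := by
    rintro m n (⟨h1, h2, h3⟩ | ⟨h1, h2, h3⟩ | ⟨h1, h2, rfl⟩)
    · exact Or.inr (Or.inl ⟨h2, h1, h3.symm⟩)
    · exact Or.inl ⟨h2, h1, h3.symm⟩
    · exact Or.inr (Or.inr ⟨h1, h2, rfl⟩)
  have hd' := Set.disjoint_left.mp hd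
  have R1 : ∀ m, ∃! n, R m n := by
    intro m
    by_cases hm : m ∈ I
    · obtain ⟨n, hn, hs⟩ := hIJ m hm
      refine ⟨n, Or.inl ⟨hm, hn, hs⟩, ?_⟩
      rintro y (⟨h1, h2, h3⟩ | ⟨h1, h2, h3⟩ | ⟨h1, h2, rfl⟩)
      · exact hJ' _ h2 _ hn (h3.symm.trans hs)
      · exact absurd h1 (hd' hm)
      · exact absurd hm h1
    · by_cases hm' : m ∈ J
      · obtain ⟨n, hn, hs⟩ := hJI m hm'
        refine ⟨n, Or.inr (Or.inl ⟨hm', hn, hs⟩), ?_⟩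
        rintro y (⟨h1, h2, h3⟩ | ⟨h1, h2, h3⟩ | ⟨h1, h2, rfl⟩)
        · exact absurd h1 hm
        · exact hI' _ h2 _ hn (h3.symm.trans hs)
        · exact absurd hm' h2
      · refine ⟨m, Or.inr (Or.inr ⟨hm, hm', rfl⟩), ?_⟩
        rintro y (⟨h1, h2, h3⟩ | ⟨h1, h2, h3⟩ | ⟨h1, h2, rfl⟩)
        · exact absurd h1 hm
        · exact absurd h1 hm'
        · rfl
  have R2 : ∀ n, ∃! m, R m n := by
    intro n
    obtain ⟨m, hm, hu⟩ := R1 n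
    exact ⟨m, Rsymm hm, fun y hy => hu y (Rsymm hy)⟩
  have Rτ : ∀ m n, R m n → R (T.τ m) (T.τ n) := by
    rintro m n (⟨h1, h2, h3⟩ | ⟨h1, h2, h3⟩ | ⟨h1, h2, rfl⟩)
    · exact Or.inl ⟨(hI.τ_mem _).mpr h1, (hJ.τ_mem _).mpr h2, h3.τ⟩
    · exact Or.inr (Or.inl ⟨(hJ.τ_mem _).mpr h1, (hI.τ_mem _).mpr h2, h3.τ⟩)
    · exact Or.inr (Or.inr ⟨(hI.τ_mem _).not.mpr h1, (hJ.τ_mem _).not.mpr h2, rfl⟩)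
  have Rσ : ∀ m n, R m n → R (T.σ m) (T.σ n) := by
    rintro m n (⟨h1, h2, h3⟩ | ⟨h1, h2, h3⟩ | ⟨h1, h2, rfl⟩)
    · exact Or.inl ⟨(hI.σ_mem _).mpr h1, (hJ.σ_mem _).mpr h2, h3.σ⟩
    · exact Or.inr (Or.inl ⟨(hJ.σ_mem _).mpr h1, (hI.σ_mem _).mpr h2, h3.σ⟩)
    · exact Or.inr (Or.inr ⟨(hI.σ_mem _).not.mpr h1, (hJ.σ_mem _).not.mpr h2, rfl⟩)
  obtain ⟨θ, hθ, hR⟩ := exists_commutes (T := T) (R := R) R1 R2 Rτ Rσ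
  refine ⟨θ, hθ, Set.Subset.antisymm ?_ ?_⟩
  · rintro _ ⟨m, hm, rfl⟩
    obtain ⟨n, hn, hs⟩ := hIJ m hm
    rwa [hR _ _ (Or.inl ⟨hm, hn, hs⟩)]
  · intro n hn
    obtain ⟨m, hm, hs⟩ := hJI n hn
    exact ⟨m, hm, hR _ _ (Or.inl ⟨hm, hn, hs.symm⟩)⟩

end TwoAdicSystem

/-! ### Schur's lemma and invariant subspaces -/

namespace Rep

section General

variable {A : Type u} [CStarAlgebra A]
  {H : Type v} [NormedAddCommGroup H] [InnerProductSpace ℂ H] [CompleteSpace H]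

/-- Schur's lemma for self-adjoint intertwiners. -/
theorem IsIrreducible.eq_smul_of_commute {π : A →⋆ₐ[ℂ] (H →L[ℂ] H)} (hπ : IsIrreducible π)
    {B : H →L[ℂ] H} (hB : IsSelfAdjoint B) (hc : ∀ a, Commute B (π a)) :
    ∃ c : ℝ, ∀ x, B x = c • x := by
  have := hπ.1
  obtain ⟨c, hcs⟩ := ContinuousFunctionalCalculus.spectrum_nonempty (R := ℝ) B hB
  refine ⟨c, fun x => ?_⟩
  suffices h : spectrum ℝ B ⊆ {c} by
    rw [CFC.eq_algebraMap_of_spectrum_subset_singleton B c h hB, Algebra.algebraMap_eq_smul_one]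
    rfl
  intro d hd
  by_contra hdc
  have hdc : d ≠ c := hdc
  -- Two spectral points `c ≠ d` carry bumps `f`, `g` of radius half their distance, so f g = 0
  -- while neither `cfc` vanishes. The kernel of `cfc f B` is then a proper nonzero closed invariant
  -- subspace.
  have hr : 0 < |c - d| / 2 := half_pos (abs_pos.mpr (sub_ne_zero.mpr hdc.symm))
  set r := |c - d| / 2 with hr'
  let f : ℝ → ℝ := fun x => max 0 (r - |x - c|)
  let g : ℝ → ℝ := fun x => max 0 (r - |x - d|)
  have hf : Continuous f := by fun_prop
  have hg : Continuous g := by fun_prop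
  have hfg : ∀ x, f x * g x = 0 := by
    intro x
    have h1 : |c - d| ≤ |x - c| + |x - d| := by
      rw [abs_sub_comm x c]
      exact abs_sub_le c x d
    rcases le_total r |x - c| with h | h
    · simp [f, max_eq_left (sub_nonpos.mpr h)]
    · have h2 : r ≤ |x - d| := by linarith
      simp [g, max_eq_left (sub_nonpos.mpr h2)]
  have hne : ∀ {k : ℝ → ℝ} {e : ℝ}, Continuous k → e ∈ spectrum ℝ B → k e ≠ 0 →
      cfc k B ≠ 0 := by
    intro k e hk he hke h
    rw [← cfc_zero ℝ B] at h
    exact hke (eqOn_of_cfc_eq_cfc (R := ℝ) (a := B) h hk.continuousOn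
      continuous_zero.continuousOn hB he)
  have hF : cfc f B ≠ 0 := hne hf hcs (by simp [f, hr.ne', hr.le])
  have hG : cfc g B ≠ 0 := hne hg hd (by simp [g, hr.ne', hr.le])
  have hFG : cfc f B * cfc g B = 0 := by
    rw [← cfc_mul f g B hf.continuousOn hg.continuousOn]
    simp only [hfg]
    exact cfc_const_zero ℝ B
  have hM : IsInvariant π (LinearMap.ker (cfc f B).toLinearMap) := by
    intro a x hx
    rw [LinearMap.mem_ker] at hx ⊢
    have h1 := congrArg (fun T : H →L[ℂ] H => T x) ((hc a).cfc_real f).eq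
    have hx' : cfc f B x = 0 := hx
    change cfc f B (π a x) = 0
    simpa [hx'] using h1
  rcases hπ.2 _ (cfc f B).isClosed_ker hM with h | h
  · refine hG (ContinuousLinearMap.ext fun x => ?_)
    have : cfc g B x ∈ LinearMap.ker (cfc f B).toLinearMap := by
      rw [LinearMap.mem_ker]
      exact congrArg (fun T : H →L[ℂ] H => T x) hFG
    rw [h] at this
    simpa using this
  · refine hF (ContinuousLinearMap.ext fun x => ?_)
    have : x ∈ LinearMap.ker (cfc f B).toLinearMap := by rw [h]; trivial
    simpa using this

theorem IsInvariant.orthogonal {ρ : A →⋆ₐ[ℂ] (H →L[ℂ] H)} {M : Submodule ℂ H}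
    (hM : IsInvariant ρ M) : IsInvariant ρ Mᗮ := by
  intro a x hx y hy
  have := hx _ (hM (star a) y hy)
  rwa [map_star, ContinuousLinearMap.star_eq_adjoint, ContinuousLinearMap.adjoint_inner_left] at this

theorem isIrreducible_subrep_iff {ρ : A →⋆ₐ[ℂ] (H →L[ℂ] H)} {N : Submodule ℂ H} [CompleteSpace N]
    (hN : IsInvariant ρ N) : IsIrreducible (subrep ρ N hN) ↔
      N ≠ ⊥ ∧ ∀ M ≤ N, IsClosed (M : Set H) → IsInvariant ρ M → M = ⊥ ∨ M = N := by
  have hNc : IsClosed (N : Set H) := (completeSpace_coe_iff_isComplete.mp ‹_›).isClosed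
  rw [IsIrreducible, Submodule.nontrivial_iff_ne_bot]
  refine and_congr_right fun _ => ⟨fun h M hMN hMc hM => ?_, fun h M hMc hM => ?_⟩
  · rcases h (M.comap N.subtype) (hMc.preimage continuous_subtype_val)
      (fun a x hx => hM a x hx) with h | h
    · left
      rw [eq_bot_iff]
      intro x hx
      have : (⟨x, hMN hx⟩ : N) ∈ M.comap N.subtype := hx
      rw [h] at this
      simpa using this
    · right
      refine le_antisymm hMN fun x hx => ?_
      have : (⟨x, hx⟩ : N) ∈ M.comap N.subtype := by rw [h]; trivial
      exact this
  · have h1 : IsClosed (M.map N.subtype : Set H) := hNc.isClosedEmbedding_subtypeVal.isClosedMap _ hMc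
    have h2 : IsInvariant ρ (M.map N.subtype) := by
      rintro a _ ⟨x, hx, rfl⟩
      exact ⟨_, hM a x hx, rfl⟩
    rcases h _ (Submodule.map_subtype_le _ _) h1 h2 with h | h
    · left
      apply Submodule.map_injective_of_injective N.injective_subtype
      rw [h, Submodule.map_bot]
    · right
      apply Submodule.map_injective_of_injective N.injective_subtype
      rw [h, Submodule.map_subtype_top]

end General

/-! ### Spans of basis vectors and permutation unitaries -/

section Basis

variable {H : Type v} [NormedAddCommGroup H] [InnerProductSpace ℂ H]
  {K : Type w} [NormedAddCommGroup K] [InnerProductSpace ℂ K] (b : HilbertBasis ℕ ℂ H)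

theorem basis_injective : Function.Injective b := b.orthonormal.linearIndependent.injective

theorem eq_zero_of_inner_basis {x : H} (h : ∀ n, inner ℂ (b n) x = 0) : x = 0 := by
  apply b.repr.injective
  ext n
  rw [b.repr_apply_apply, h, map_zero]
  rfl

variable {b} in
theorem clm_ext_basis {f g : H →L[ℂ] K} (h : ∀ n, f (b n) = g (b n)) : f = g := by
  refine ContinuousLinearMap.ext_on
    ((Submodule.dense_iff_topologicalClosure_eq_top).mpr b.dense_span) ?_
  rintro _ ⟨n, rfl⟩
  exact h n

theorem basis_mem_basisSpan {I : Set ℕ} {n : ℕ} (h : n ∈ I) : b n ∈ basisSpan b I :=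
  Submodule.le_topologicalClosure _ (Submodule.subset_span ⟨n, h, rfl⟩)

theorem isClosed_basisSpan (I : Set ℕ) : IsClosed (basisSpan b I : Set H) :=
  Submodule.isClosed_topologicalClosure _

variable {b} in
theorem basisSpan_le {I : Set ℕ} {M : Submodule ℂ H} (hM : IsClosed (M : Set H))
    (h : ∀ n ∈ I, b n ∈ M) : basisSpan b I ≤ M := by
  refine Submodule.topologicalClosure_minimal _ (Submodule.span_le.mpr ?_) hM
  rintro _ ⟨n, hn, rfl⟩
  exact h n hn

variable {b} in
theorem inner_basis_of_notMem {I : Set ℕ} {n : ℕ} (h : n ∉ I) {x : H} (hx : x ∈ basisSpan b I) :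
    inner ℂ (b n) x = 0 := by
  have : basisSpan b I ≤ (ℂ ∙ b n)ᗮ := by
    refine basisSpan_le (Submodule.isClosed_orthogonal _) fun m hm => ?_
    rw [Submodule.mem_orthogonal_singleton_iff_inner_right]
    exact b.orthonormal.2 fun e => h (e ▸ hm)
  exact Submodule.mem_orthogonal_singleton_iff_inner_right.mp (this hx)

theorem basis_mem_basisSpan_iff {I : Set ℕ} {n : ℕ} : b n ∈ basisSpan b I ↔ n ∈ I := by
  refine ⟨fun h => ?_, basis_mem_basisSpan b⟩
  by_contra hn
  exact b.orthonormal.ne_zero n (inner_self_eq_zero.mp (inner_basis_of_notMem hn h))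

theorem basisSpan_le_orthogonal {I J : Set ℕ} (h : Disjoint I J) :
    basisSpan b I ≤ (basisSpan b J)ᗮ := by
  refine basisSpan_le (Submodule.isClosed_orthogonal _) fun n hn => ?_
  rw [Submodule.mem_orthogonal']
  exact fun x hx => inner_basis_of_notMem (Set.disjoint_left.mp h hn) hx

variable [CompleteSpace H]

theorem isHilbertSum_basisSpan {J : Type} {I : J → Set ℕ} (hd : Pairwise fun j k => Disjoint (I j) (I k))
    (hc : ∀ n, ∃ j, n ∈ I j) :
    IsHilbertSum ℂ (fun j => basisSpan b (I j)) (fun j => (basisSpan b (I j)).subtypeₗᵢ) := by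
  refine IsHilbertSum.mkInternal _ (fun j k hjk x y => ?_) ?_
  · exact (Submodule.mem_orthogonal' _ _).mp (basisSpan_le_orthogonal b (hd hjk) x.2) _ y.2
  · rw [← b.dense_span]
    refine Submodule.topologicalClosure_mono (Submodule.span_le.mpr ?_)
    rintro _ ⟨n, rfl⟩
    obtain ⟨j, hj⟩ := hc n
    exact Submodule.mem_iSup_of_mem j (basis_mem_basisSpan b hj)

variable {b} in
theorem exists_mem_of_isHilbertSum {J : Type} {I : J → Set ℕ}
    (h : IsHilbertSum ℂ (fun j => basisSpan b (I j)) (fun j => (basisSpan b (I j)).subtypeₗᵢ))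
    (n : ℕ) : ∃ j, n ∈ I j := by
  by_contra! hn
  obtain ⟨f, hf⟩ := h.surjective_isometry (b n)
  have h1 := h.OrthogonalFamily.hasSum_linearIsometry f
  rw [hf] at h1
  have h2 := h1.mapL (innerSL ℂ (b n))
  have h3 : ∀ j, innerSL ℂ (b n) ((basisSpan b (I j)).subtypeₗᵢ (f j)) = 0 := fun j =>
    inner_basis_of_notMem (hn j) (f j).2
  simp only [h3] at h2
  have h4 := h2.unique hasSum_zero
  exact b.orthonormal.ne_zero n (inner_self_eq_zero.mp h4)

variable {b} in
theorem disjoint_of_isHilbertSum {J : Type} {I : J → Set ℕ}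
    (h : IsHilbertSum ℂ (fun j => basisSpan b (I j)) (fun j => (basisSpan b (I j)).subtypeₗᵢ))
    {j k : J} (hjk : j ≠ k) : Disjoint (I j) (I k) := by
  rw [Set.disjoint_left]
  intro n hj hk
  have := h.OrthogonalFamily hjk ⟨b n, basis_mem_basisSpan b hj⟩ ⟨b n, basis_mem_basisSpan b hk⟩
  exact b.orthonormal.ne_zero n (inner_self_eq_zero.mp this)

/-- The unitary permuting the basis vectors. -/
noncomputable def permUnitary (θ : Equiv.Perm ℕ) : H ≃ₗᵢ[ℂ] H :=
  b.repr.trans (HilbertBasis.mk (b.orthonormal.comp θ θ.injective)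
    (by rw [Set.range_comp, θ.range_eq_univ, Set.image_univ, b.dense_span])).repr.symm

theorem permUnitary_basis (θ : Equiv.Perm ℕ) (n : ℕ) : permUnitary b θ (b n) = b (θ n) := by
  classical
  rw [permUnitary, LinearIsometryEquiv.trans_apply, b.repr_self, HilbertBasis.repr_symm_single,
    HilbertBasis.coe_mk]
  rfl

theorem permUnitary_symm_basis (θ : Equiv.Perm ℕ) (n : ℕ) :
    (permUnitary b θ).symm (b n) = b (θ.symm n) := by
  rw [LinearIsometryEquiv.symm_apply_eq, permUnitary_basis, Equiv.apply_symm_apply]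

theorem map_permUnitary (θ : Equiv.Perm ℕ) (I : Set ℕ) :
    (basisSpan b I).map (permUnitary b θ).toLinearEquiv.toLinearMap = basisSpan b (θ '' I) := by
  apply le_antisymm
  · rw [Submodule.map_le_iff_le_comap]
    refine basisSpan_le ((isClosed_basisSpan b _).preimage (permUnitary b θ).continuous) ?_
    intro n hn
    have h := basis_mem_basisSpan b (Set.mem_image_of_mem θ hn)
    rwa [← permUnitary_basis] at h
  · refine basisSpan_le ?_ ?_
    · exact (permUnitary b θ).toHomeomorph.isClosedMap _ (isClosed_basisSpan b I)
    · rintro _ ⟨n, hn, rfl⟩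
      exact ⟨b n, basis_mem_basisSpan b hn, permUnitary_basis b θ n⟩

end Basis

end Rep

/-! ### From permutative representations to systems on the index set -/

section

open TwoAdicRingAlgebra Rep

variable {H : Type u} [NormedAddCommGroup H] [InnerProductSpace ℂ H] [CompleteSpace H]
  {ρ : TwoAdicRingAlgebra.{u} →⋆ₐ[ℂ] (H →L[ℂ] H)} {b : HilbertBasis ℕ ℂ H} {T : TwoAdicSystem}

/-- The generators act on the basis through the system `T`. -/
structure TwoAdicSystem.Implements (T : TwoAdicSystem)
    (ρ : TwoAdicRingAlgebra.{u} →⋆ₐ[ℂ] (H →L[ℂ] H)) (b : HilbertBasis ℕ ℂ H) : Prop where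
  S_basis : ∀ n, ρ S₂ (b n) = b (T.σ n)
  U_basis : ∀ n, ρ U (b n) = b (T.τ n)

theorem map_relations (ρ : TwoAdicRingAlgebra.{u} →⋆ₐ[ℂ] (H →L[ℂ] H)) :
    TwoAdicRelations (H →L[ℂ] H) (ρ U) (ρ S₂) where
  star_U_mul := by simpa [map_star] using congrArg ρ relations.star_U_mul
  U_mul_star := by simpa [map_star] using congrArg ρ relations.U_mul_star
  isometry := by simpa [map_star] using congrArg ρ relations.isometry
  comm := by simpa using congrArg ρ relations.comm
  sum := by simpa [map_star] using congrArg ρ relations.sum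

theorem star_apply_of_isometry {V : H →L[ℂ] H} (hV : star V * V = 1) (x : H) : star V (V x) = x :=
  congrArg (fun W : H →L[ℂ] H => W x) hV

theorem star_basis_eq_zero {V : H →L[ℂ] H} {f : ℕ → ℕ} (hV : ∀ n, V (b n) = b (f n)) {n : ℕ}
    (hn : ∀ m, n ≠ f m) : star V (b n) = 0 := by
  refine eq_zero_of_inner_basis b fun m => ?_
  rw [ContinuousLinearMap.star_eq_adjoint, ContinuousLinearMap.adjoint_inner_right, hV]
  exact b.orthonormal.2 (hn m).symm

theorem TwoAdicRingAlgebra.IsPermutative.exists_implements (h : IsPermutative ρ b) :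
    ∃ T : TwoAdicSystem, T.Implements ρ b := by
  obtain ⟨σ, τ, hσ, h⟩ := h
  have hS : ∀ n, ρ S₂ (b n) = b (σ n) := fun n => (h n).1
  have hU : ∀ n, ρ U (b n) = b (τ n) := fun n => (h n).2
  have hrel := map_relations ρ
  have hSS : ∀ n, star (ρ S₂) (b (σ n)) = b n := fun n => by
    rw [← hS, star_apply_of_isometry hrel.isometry]
  have hUU : ∀ n, star (ρ U) (b (τ n)) = b n := fun n => by
    rw [← hU, star_apply_of_isometry hrel.star_U_mul]
  have hsum : ∀ x, ρ S₂ (star (ρ S₂) x) + ρ U (ρ S₂ (star (ρ S₂) (star (ρ U) x))) = x := fun x =>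
    congrArg (fun W : H →L[ℂ] H => W x) hrel.sum
  refine ⟨⟨σ, τ, hσ, fun n => ?_, fun m n hmn => ?_, fun n => ?_⟩, hS, hU⟩
  · have h1 : ρ S₂ (ρ U (b n)) = ρ U (ρ U (ρ S₂ (b n))) := by
      have := congrArg (fun W : H →L[ℂ] H => W (b n)) hrel.comm
      rwa [pow_two] at this
    rw [hU, hS, hS, hU, hU] at h1
    exact basis_injective b h1
  · have h1 := hsum (b (σ m))
    -- If the ranges met, both terms of the sum relation would fix this basis vector, giving v + v =
    -- v.
    rw [hSS, hS, hmn, hUU, hSS, hS, hU] at h1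
    exact b.orthonormal.ne_zero _ (left_eq_add.mp h1.symm)
  · by_contra! hn
    have h1 := hsum (b n)
    have h2 : star (ρ U) (b n) = b (τ.symm n) := by
      conv_lhs => rw [← τ.apply_symm_apply n, hUU]
    rw [star_basis_eq_zero hS hn.1, h2, star_basis_eq_zero hS fun m hm => hn.2 m
      ((Equiv.symm_apply_eq τ).mp hm)] at h1
    simp only [map_zero, add_zero] at h1
    exact b.orthonormal.ne_zero n h1.symm

/-- A unitary commuting with the generators commutes with the whole representation. -/
theorem commute_of_commute_generators {W : H ≃ₗᵢ[ℂ] H} (hS : ∀ n, W (ρ S₂ (b n)) = ρ S₂ (W (b n)))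
    (hU : ∀ n, W (ρ U (b n)) = ρ U (W (b n))) (a : TwoAdicRingAlgebra.{u}) (x : H) :
    W (ρ a x) = ρ a (W x) := by
  let w := Unitary.linearIsometryEquiv.symm W
  let φ : TwoAdicRingAlgebra.{u} →⋆ₐ[ℂ] (H →L[ℂ] H) :=
    ((Unitary.conjStarAlgAut ℂ (H →L[ℂ] H) w : _ →⋆ₐ[ℂ] _)).comp ρ
  have key : ∀ a, φ a = (w : H →L[ℂ] H) * ρ a * (star w : H →L[ℂ] H) := fun _ => rfl
  have hgen : ∀ a, (∀ n, W (ρ a (b n)) = ρ a (W (b n))) → φ a = ρ a := by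
    intro a ha
    have h1 : (w : H →L[ℂ] H) * ρ a = ρ a * (w : H →L[ℂ] H) := clm_ext_basis ha
    rw [key, h1, mul_assoc, Unitary.mul_star_self_of_mem w.2, mul_one]
  -- Conjugating `ρ` by `W` gives a representation agreeing with `ρ` on the generators, so
  -- uniqueness in the universal property applies; no density argument is needed.
  have hφ : φ = ρ :=
    (TwoAdicRingAlgebra.existsUnique_hom (map_relations ρ)).unique ⟨hgen _ hU, hgen _ hS⟩ ⟨rfl, rfl⟩
  have h2 : (w : H →L[ℂ] H) * ρ a = ρ a * (w : H →L[ℂ] H) := by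
    conv_rhs => rw [← hφ, key, mul_assoc, Unitary.star_mul_self_of_mem w.2, mul_one]
  exact congrArg (fun V : H →L[ℂ] H => V x) h2

namespace TwoAdicSystem

theorem Implements.permUnitary_commute (hT : T.Implements ρ b) {θ : Equiv.Perm ℕ}
    (hθ : T.Commutes θ) (a : TwoAdicRingAlgebra.{u}) (x : H) :
    permUnitary b θ (ρ a x) = ρ a (permUnitary b θ x) := by
  refine commute_of_commute_generators (b := b) (fun n => ?_) (fun n => ?_) a x
  · rw [hT.S_basis, permUnitary_basis, permUnitary_basis, hT.S_basis, hθ.σ_apply]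
  · rw [hT.U_basis, permUnitary_basis, permUnitary_basis, hT.U_basis, hθ.τ_apply]

theorem Implements.invariant_of_isInvariant (hT : T.Implements ρ b) {M : Submodule ℂ H}
    (hM : IsInvariant ρ M) : T.Invariant {n | b n ∈ M} where
  τ_mem n := by
    refine ⟨fun h => ?_, fun h => ?_⟩
    · have := hM (star U) _ h
      rwa [← hT.U_basis, map_star, star_apply_of_isometry (map_relations ρ).star_U_mul] at this
    · have := hM U _ h
      rwa [hT.U_basis] at this
  σ_mem n := by
    refine ⟨fun h => ?_, fun h => ?_⟩
    · have := hM (star S₂) _ h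
      rwa [← hT.S_basis, map_star, star_apply_of_isometry (map_relations ρ).isometry] at this
    · have := hM S₂ _ h
      rwa [hT.S_basis] at this

/-- For an invariant `I` the reflection in the span acts on basis vectors by signs constant along
`τ` and `σ`. It is a unitary commuting with the generators, hence with all of `ρ`, and the span is
its fixed space. -/
theorem Implements.isInvariant_basisSpan_iff (hT : T.Implements ρ b) {I : Set ℕ} :
    IsInvariant ρ (basisSpan b I) ↔ T.Invariant I := by
  constructor
  · intro h
    have := hT.invariant_of_isInvariant h
    simp only [basis_mem_basisSpan_iff] at this
    exact this
  · intro h a x hx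
    have hin : ∀ {n}, n ∈ I → (basisSpan b I).reflection (b n) = b n := fun hn =>
      Submodule.reflection_mem_subspace_eq_self (basis_mem_basisSpan b hn)
    have hout : ∀ {n}, n ∉ I → (basisSpan b I).reflection (b n) = -b n := fun hn =>
      Submodule.reflection_mem_subspace_orthogonalComplement_eq_neg
        (basisSpan_le_orthogonal b (I := {_}) (Set.disjoint_singleton_left.mpr hn)
          (basis_mem_basisSpan b rfl))
    have hc := commute_of_commute_generators (ρ := ρ) (b := b) (W := (basisSpan b I).reflection)
      (fun n => by
        by_cases hn : n ∈ I
        · rw [hT.S_basis, hin hn, hin ((h.σ_mem n).mpr hn), hT.S_basis]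
        · rw [hT.S_basis, hout hn, hout ((h.σ_mem n).not.mpr hn), map_neg, hT.S_basis])
      (fun n => by
        by_cases hn : n ∈ I
        · rw [hT.U_basis, hin hn, hin ((h.τ_mem n).mpr hn), hT.U_basis]
        · rw [hT.U_basis, hout hn, hout ((h.τ_mem n).not.mpr hn), map_neg, hT.U_basis]) a x
    rw [Submodule.reflection_mem_subspace_eq_self hx] at hc
    exact (Submodule.reflection_eq_self_iff _).mp hc

/-- The set of indices of an irreducible summand is a minimal invariant set. -/
theorem Implements.subset_of_isIrreducible (hT : T.Implements ρ b) {I S : Set ℕ}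
    {hI : IsInvariant ρ (basisSpan b I)} (hirr : IsIrreducible (subrep ρ (basisSpan b I) hI))
    (hS : T.Invariant S) {n : ℕ} (hn : n ∈ I) (hnS : n ∈ S) : I ⊆ S := by
  have hI' := hT.isInvariant_basisSpan_iff.mp hI
  have hIS : T.Invariant (I ∩ S) :=
    ⟨fun m => and_congr (hI'.τ_mem m) (hS.τ_mem m), fun m => and_congr (hI'.σ_mem m) (hS.σ_mem m)⟩
  rcases ((isIrreducible_subrep_iff hI).mp hirr).2 (basisSpan b (I ∩ S))
    (basisSpan_le (isClosed_basisSpan b I) fun m hm => basis_mem_basisSpan b hm.1)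
    (isClosed_basisSpan b _) (hT.isInvariant_basisSpan_iff.mpr hIS) with h | h
  · have h1 := basis_mem_basisSpan b (I := I ∩ S) ⟨hn, hnS⟩
    rw [h, Submodule.mem_bot] at h1
    exact absurd h1 (b.orthonormal.ne_zero n)
  · intro m hm
    have h1 := basis_mem_basisSpan b hm
    rw [← h] at h1
    exact ((basis_mem_basisSpan_iff b).mp h1).2

/-- A permutation commuting with the system cannot move a point of an irreducible summand within
that summand. -/
theorem Implements.apply_eq_of_isIrreducible (hT : T.Implements ρ b) {I : Set ℕ}
    {hI : IsInvariant ρ (basisSpan b I)} (hirr : IsIrreducible (subrep ρ (basisSpan b I) hI))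
    {θ : Equiv.Perm ℕ} (hθ : T.Commutes θ) {n : ℕ} (hn : n ∈ I) (hθn : θ n ∈ I) : θ n = n := by
  by_contra hne
  have hI' := hT.isInvariant_basisSpan_iff.mp hI
  have hθ' : T.Commutes θ.symm :=
    ⟨fun m => by rw [Equiv.symm_apply_eq, hθ.τ_apply, Equiv.apply_symm_apply],
      fun m => by rw [Equiv.symm_apply_eq, hθ.σ_apply, Equiv.apply_symm_apply]⟩
  -- The preimage of `I` under `η` is invariant and meets `I`, so by minimality it contains `I`.
  have hpre : ∀ {η : Equiv.Perm ℕ}, T.Commutes η → ∀ {m}, m ∈ I → η m ∈ I → ∀ k ∈ I, η k ∈ I := by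
    intro η hη m hm hηm k hk
    have hinv : T.Invariant {m | η m ∈ I} :=
      ⟨fun m => by rw [Set.mem_ofPred, hη.τ_apply, hI'.τ_mem]; rfl,
        fun m => by rw [Set.mem_ofPred, hη.σ_apply, hI'.σ_mem]; rfl⟩
    exact hT.subset_of_isIrreducible hirr hinv hm hηm hk
  have h1 := hpre hθ hn hθn
  have h2 := hpre hθ' hθn (by simpa using hn)
  set W := permUnitary b θ with hW
  let N := basisSpan b I
  -- The unitary itself need not be self-adjoint; its sum with its inverse is, and still commutes
  -- with `ρ`.
  let C : H →L[ℂ] H := (W : H →L[ℂ] H) + (W.symm : H →L[ℂ] H)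
  have hC : ∀ x, C x = W x + W.symm x := fun _ => rfl
  have hCN : N ≤ N.comap C.toLinearMap := by
    refine basisSpan_le ((isClosed_basisSpan b I).preimage C.continuous) fun m hm => ?_
    refine N.add_mem ?_ ?_
    · have := basis_mem_basisSpan b (h1 m hm)
      rwa [← permUnitary_basis] at this
    · have := basis_mem_basisSpan b (h2 m hm)
      rwa [← permUnitary_symm_basis] at this
  let B : N →L[ℂ] N := (C.comp N.subtypeL).codRestrict N fun x => hCN x.2
  have hB : ∀ x, ((B x : N) : H) = W x + W.symm x := fun _ => rfl
  have hself : IsSelfAdjoint B := by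
    rw [ContinuousLinearMap.isSelfAdjoint_iff', eq_comm, ContinuousLinearMap.eq_adjoint_iff]
    intro x y
    rw [Submodule.coe_inner, Submodule.coe_inner, hB, hB, inner_add_left, inner_add_right,
      ← W.inner_map_map (W.symm x), ← W.inner_map_map x (W.symm y), W.apply_symm_apply,
      W.apply_symm_apply, add_comm]
  have hcomm : ∀ a, Commute B (subrep ρ (basisSpan b I) hI a) := by
    intro a
    refine ContinuousLinearMap.ext fun x => Subtype.ext ?_
    change W (ρ a x) + W.symm (ρ a x) = ρ a (W x + W.symm x)
    have h3 : W.symm (ρ a x) = ρ a (W.symm x) := by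
      rw [LinearIsometryEquiv.symm_apply_eq, hT.permUnitary_commute hθ,
        LinearIsometryEquiv.apply_symm_apply]
    rw [hT.permUnitary_commute hθ, h3, map_add]
  obtain ⟨c, hc⟩ := hirr.eq_smul_of_commute hself hcomm
  have h4 : b (θ n) + b (θ.symm n) = c • b n := by
    have := congrArg (Subtype.val) (hc ⟨b n, basis_mem_basisSpan b hn⟩)
    rw [hB] at this
    simp only [hW, permUnitary_basis, permUnitary_symm_basis] at this
    exact this
  have h5 := congrArg (fun x => RCLike.re (inner ℂ (b (θ n)) x)) h4
  have h6 := orthonormal_iff_ite.mp b.orthonormal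
  simp only [inner_add_right, inner_smul_right_eq_smul, h6, hne, if_true, if_false] at h5
  -- Pairing with `b (θ n)` gives 1 or 2 on the left, according to whether `θ n = θ.symm n`, and 0
  -- on the right.
  split_ifs at h5 <;> norm_num at h5

/-! ### Range projections, irreducibility and inequivalence -/

theorem exists_res_nat (k n : ℕ) : ∃ r : ℕ, T.Res k n r := by
  obtain ⟨r, hr⟩ := exists_res (T := T) k n
  have h0 : (0 : ℤ) < 2 ^ k := by positivity
  refine ⟨(r % 2 ^ k).toNat, ?_⟩
  rw [Int.toNat_of_nonneg (Int.emod_nonneg _ h0.ne'), hr.iff_dvd]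
  exact Int.dvd_self_sub_emod

/-- The range projection of `U ^ r * S₂ ^ k`. -/
noncomputable def rangeProj (k r : ℕ) : TwoAdicRingAlgebra.{u} :=
  U ^ r * S₂ ^ k * star (U ^ r * S₂ ^ k)

theorem Implements.word_basis (hT : T.Implements ρ b) (k r n : ℕ) :
    ρ (U ^ r * S₂ ^ k) (b n) = b ((T.τ ^ (r : ℤ)) (T.σ^[k] n)) := by
  have h1 : ∀ n, ρ (S₂ ^ k) (b n) = b (T.σ^[k] n) := by
    induction k with
    | zero => simp
    | succ k ih =>
      intro n
      rw [pow_succ, map_mul, Function.iterate_succ_apply, ← ih, ← hT.S_basis]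
      rfl
  have h2 : ∀ n, ρ (U ^ r) (b n) = b ((T.τ ^ (r : ℤ)) n) := by
    induction r with
    | zero => simp
    | succ r ih =>
      intro n
      rw [pow_succ, map_mul, zpow_natCast, pow_succ, Equiv.Perm.mul_apply, ← zpow_natCast, ← ih,
        ← hT.U_basis]
      rfl
  rw [map_mul, ← h2, ← h1]
  rfl

theorem Implements.rangeProj_basis (hT : T.Implements ρ b) {k r n : ℕ} (h : T.Res k n r) :
    ρ (rangeProj k r) (b n) = b n := by
  obtain ⟨m, rfl⟩ := h
  have hiso : star (U ^ r * S₂ ^ k : TwoAdicRingAlgebra.{u}) * (U ^ r * S₂ ^ k) = 1 := by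
    have hU : star (U ^ r : TwoAdicRingAlgebra.{u}) * U ^ r = 1 := by
      induction r with
      | zero => simp
      | succ r ih =>
        rw [pow_succ, star_mul, mul_assoc, ← mul_assoc _ (U ^ r) U, ih, one_mul,
          relations.star_U_mul]
    have hS : star (S₂ ^ k : TwoAdicRingAlgebra.{u}) * S₂ ^ k = 1 := by
      induction k with
      | zero => simp
      | succ k ih =>
        rw [pow_succ, star_mul, mul_assoc, ← mul_assoc _ (S₂ ^ k) S₂, ih, one_mul,
          relations.isometry]
    rw [star_mul, mul_assoc, ← mul_assoc _ (U ^ r), hU, one_mul, hS]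
  rw [← hT.word_basis]
  have h1 : rangeProj k r * (U ^ r * S₂ ^ k) = (U ^ r * S₂ ^ k : TwoAdicRingAlgebra.{u}) := by
    rw [rangeProj, mul_assoc, hiso, mul_one]
  have h2 := congrArg ρ h1
  rw [map_mul] at h2
  exact congrArg (fun V : H →L[ℂ] H => V (b m)) h2

theorem Implements.rangeProj_basis_of_not (hT : T.Implements ρ b) {k r n : ℕ}
    (h : ¬ T.Res k n r) : ρ (rangeProj k r) (b n) = 0 := by
  have h1 := star_basis_eq_zero (hT.word_basis k r) (n := n) fun m hm => h ⟨m, hm⟩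
  rw [rangeProj, map_mul ρ (U ^ r * S₂ ^ k), map_star]
  change ρ (U ^ r * S₂ ^ k) (star (ρ (U ^ r * S₂ ^ k)) (b n)) = 0
  rw [h1, map_zero]

/-- A vector fixed by the range projections containing `b n` is supported on the indices with the
same code as `n`. -/
theorem Implements.inner_eq_zero (hT : T.Implements ρ b) {n : ℕ} {x : H}
    (hx : ∀ k r : ℕ, T.Res k n r → ρ (rangeProj k r) x = x) {m : ℕ} (hm : ¬ T.Same n m) :
    inner ℂ (b m) x = 0 := by
  by_contra hne
  refine hm (same_of_res fun k => ?_)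
  obtain ⟨r, hr⟩ := exists_res_nat (T := T) k n
  refine ⟨r, hr, ?_⟩
  by_contra hmr
  apply hne
  have hstar : star (rangeProj k r : TwoAdicRingAlgebra.{u}) = rangeProj k r := by
    rw [rangeProj, star_mul, star_star]
  rw [← hx k r hr, ← hstar, map_star, ContinuousLinearMap.star_eq_adjoint,
    ContinuousLinearMap.adjoint_inner_right, hT.rangeProj_basis_of_not hmr, inner_zero_left]

/-- By connectedness, a closed invariant subspace containing one basis vector of `I` contains them
all. Otherwise every such basis vector is orthogonal to it. -/
theorem Implements.isIrreducible (hT : T.Implements ρ b) {I : Set ℕ}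
    (hI : IsInvariant ρ (basisSpan b I)) (hne : I.Nonempty)
    (hconn : ∀ m ∈ I, ∀ n ∈ I, T.Connected m n) (hinj : ∀ m ∈ I, ∀ n ∈ I, T.Same m n → m = n) :
    IsIrreducible (subrep ρ (basisSpan b I) hI) := by
  rw [isIrreducible_subrep_iff]
  obtain ⟨n₀, hn₀⟩ := hne
  refine ⟨fun h => ?_, fun M hMI hMc hM => ?_⟩
  · have h1 := basis_mem_basisSpan b hn₀
    rw [h, Submodule.mem_bot] at h1
    exact b.orthonormal.ne_zero _ h1
  have : CompleteSpace M := hMc.completeSpace_coe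
  by_cases hex : ∃ n ∈ I, b n ∈ M
  · right
    obtain ⟨n, hn, hnM⟩ := hex
    refine le_antisymm hMI (basisSpan_le hMc fun m hm => ?_)
    exact (hT.invariant_of_isInvariant hM).mem_of_connected (hconn n hn m hm) hnM
  · left
    push Not at hex
    have hperp : basisSpan b I ≤ Mᗮ := by
      refine basisSpan_le (Submodule.isClosed_orthogonal _) fun n hn => ?_
      obtain ⟨f, hf, g, hg, hfg⟩ := M.exists_add_mem_mem_orthogonal (b n)
      -- Range projections preserve `M` and its complement, so fixing `b n` forces fixing its
      -- component `f`.
      have hfix : ∀ k r : ℕ, T.Res k n r → ρ (rangeProj k r) f = f := by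
        intro k r hr
        have h1 := hT.rangeProj_basis hr
        rw [hfg, map_add] at h1
        have h2 : ρ (rangeProj k r) f - f = g - ρ (rangeProj k r) g := by
          rw [sub_eq_sub_iff_add_eq_add, h1, add_comm]
        have h3 : ρ (rangeProj k r) f - f ∈ M := M.sub_mem (hM _ _ hf) hf
        have h4 : ρ (rangeProj k r) f - f ∈ Mᗮ := by
          rw [h2]
          exact Mᗮ.sub_mem hg (hM.orthogonal _ _ hg)
        exact sub_eq_zero.mp (inner_self_eq_zero.mp (h4 _ h3))
      have hfn : f = inner ℂ (b n) f • b n := by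
        rw [← sub_eq_zero]
        refine eq_zero_of_inner_basis b fun m => ?_
        rw [inner_sub_right, inner_smul_right, orthonormal_iff_ite.mp b.orthonormal m n]
        split_ifs with hmn
        · subst hmn; simp
        · rw [mul_zero, sub_zero]
          by_cases hm : m ∈ I
          · exact hT.inner_eq_zero hfix fun hs => hmn (hinj n hn m hm hs).symm
          · exact inner_basis_of_notMem hm (hMI hf)
      by_cases hc : inner ℂ (b n) f = 0
      · rw [hc, zero_smul] at hfn
        rw [hfg, hfn, zero_add]
        exact hg
      · rw [hfn] at hf
        exact absurd ((M.smul_mem_iff hc).mp hf) (hex n hn)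
    rw [eq_bot_iff, ← M.inf_orthogonal_eq_bot]
    exact le_inf le_rfl (hMI.trans hperp)

/-- An intertwiner would send `b n` to a vector fixed by the same range projections, hence supported
on indices of `J` with the code of `n`. There are none. -/
theorem Implements.not_unitarilyEquivalent (hT : T.Implements ρ b) {I J : Set ℕ}
    (hI : IsInvariant ρ (basisSpan b I)) (hJ : IsInvariant ρ (basisSpan b J)) {n : ℕ} (hn : n ∈ I)
    (hIJ : ∀ m ∈ J, ¬ T.Same n m) :
    ¬ UnitarilyEquivalent (subrep ρ (basisSpan b I) hI) (subrep ρ (basisSpan b J) hJ) := by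
  rintro ⟨V, hV⟩
  let x : basisSpan b I := ⟨b n, basis_mem_basisSpan b hn⟩
  have hx : (V x : H) = 0 := by
    refine eq_zero_of_inner_basis b fun m => ?_
    by_cases hm : m ∈ J
    · refine hT.inner_eq_zero (n := n) (fun k r hr => ?_) (hIJ m hm)
      have h1 : subrep ρ (basisSpan b I) hI (rangeProj k r) x = x :=
        Subtype.ext (hT.rangeProj_basis hr)
      have h2 := hV (rangeProj k r) x
      rw [h1] at h2
      exact (congrArg Subtype.val h2).symm
    · exact inner_basis_of_notMem hm (V x).2
  have h3 : V x = 0 := Subtype.ext hx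
  rw [LinearIsometryEquiv.map_eq_zero_iff] at h3
  exact b.orthonormal.ne_zero n (congrArg Subtype.val h3)

theorem Implements.unitarilyEquivalent (hT : T.Implements ρ b) {I J : Set ℕ}
    (hI : IsInvariant ρ (basisSpan b I)) (hJ : IsInvariant ρ (basisSpan b J)) {θ : Equiv.Perm ℕ}
    (hθ : T.Commutes θ) (hIJ : θ '' I = J) :
    UnitarilyEquivalent (subrep ρ (basisSpan b I) hI) (subrep ρ (basisSpan b J) hJ) := by
  let W := permUnitary b θ
  refine ⟨⟨W.toLinearEquiv.ofSubmodules _ _ (by rw [← hIJ]; exact map_permUnitary b θ I),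
    fun x => W.norm_map x⟩, fun a x => Subtype.ext ?_⟩
  exact hT.permUnitary_commute hθ a x

/-! ### Restriction to `O₂` and the two equivalences -/

theorem Implements.isImplementedBy (hT : T.Implements ρ b) :
    CuntzAlgebra.IsImplementedBy (CuntzAlgebra.restrict ρ) b T.branching := by
  intro n
  constructor
  · change ρ (CuntzAlgebra.toTwoAdic CuntzAlgebra.X₁) (b n) = b (T.τ (T.σ n))
    rw [CuntzAlgebra.toTwoAdic_X₁, map_mul, ← hT.U_basis, ← hT.S_basis]
    rfl
  · change ρ (CuntzAlgebra.toTwoAdic CuntzAlgebra.X₂) (b n) = b (T.σ n)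
    rw [CuntzAlgebra.toTwoAdic_X₂, ← hT.S_basis]

/-- This makes the existential quantifier over branching systems in the definitions harmless. -/
theorem Implements.eq_branching (hT : T.Implements ρ b) {s : BranchingSystem}
    (hs : CuntzAlgebra.IsImplementedBy (CuntzAlgebra.restrict ρ) b s) : s = T.branching := by
  have h : s.map = T.branching.map := by
    funext i n
    apply basis_injective b
    fin_cases i
    · exact (hs n).1.symm.trans (hT.isImplementedBy n).1
    · exact (hs n).2.symm.trans (hT.isImplementedBy n).2
  cases s
  cases hB : T.branching
  rw [hB] at h
  congr

theorem Implements.isRegular_iff (hT : T.Implements ρ b) :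
    CuntzAlgebra.IsRegular (CuntzAlgebra.restrict ρ) b ↔ T.branching.CodingPartiallyInjective := by
  refine ⟨?_, fun h => ⟨_, hT.isImplementedBy, h⟩⟩
  rintro ⟨s, hs, h⟩
  rwa [hT.eq_branching hs] at h

theorem Implements.isMultiplicityFree_iff (hT : T.Implements ρ b) :
    CuntzAlgebra.IsMultiplicityFree (CuntzAlgebra.restrict ρ) b ↔
      ∀ m n, T.Same m n → m = n := by
  have h : Function.Injective T.branching.coding ↔ ∀ m n, T.Same m n → m = n := by
    simp only [Function.Injective, coding_eq_iff]
  rw [← h]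
  refine ⟨?_, fun h => ⟨_, hT.isImplementedBy, h⟩⟩
  rintro ⟨s, hs, h⟩
  rwa [hT.eq_branching hs] at h

/-- The orbits decompose a regular representation into irreducible permutative ones. -/
theorem Implements.isIrreducibleDecomposition (hT : T.Implements ρ b)
    (hreg : T.branching.CodingPartiallyInjective) :
    IsIrreducibleDecomposition ρ b
      fun j : Quotient T.orbitSetoid => {n | (Quotient.mk T.orbitSetoid n) = j} := by
  have hI : ∀ j : Quotient T.orbitSetoid,
      IsInvariant ρ (basisSpan b {n | (Quotient.mk T.orbitSetoid n) = j}) := by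
    intro j
    rw [hT.isInvariant_basisSpan_iff]
    exact ⟨fun n => by rw [Set.mem_ofPred, ← Quotient.sound (s := T.orbitSetoid) (connected_τ n)]; rfl,
      fun n => by rw [Set.mem_ofPred, ← Quotient.sound (s := T.orbitSetoid) (connected_σ n)]; rfl⟩
  have hconn : ∀ (j : Quotient T.orbitSetoid) (m n : ℕ), Quotient.mk T.orbitSetoid m = j →
      Quotient.mk T.orbitSetoid n = j → T.Connected m n := fun j m n hm hn =>
    Quotient.exact (s := T.orbitSetoid) (hm.trans hn.symm)
  refine ⟨hI, fun j => ?_, isHilbertSum_basisSpan b (fun j k hjk => ?_) fun n => ⟨_, rfl⟩⟩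
  · refine hT.isIrreducible (hI j) (Quotient.exists_rep j) (fun m hm n hn => hconn j m n hm hn)
      fun m hm n hn hs => eq_of_same_of_connected hreg (hconn j m n hm hn) hs
  · exact Set.disjoint_left.mpr fun n hj hk => hjk (hj.symm.trans hk)

/-- A word keeps `n` inside its summand, so the symmetry produced by equal codes moves `n` within an
irreducible summand and must fix it. -/
theorem Implements.codingPartiallyInjective (hT : T.Implements ρ b) {J : Type} {I : J → Set ℕ}
    (h : IsIrreducibleDecomposition ρ b I) : T.branching.CodingPartiallyInjective := by
  intro n l hl
  rw [coding_eq_iff] at hl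
  obtain ⟨j, hj⟩ := exists_mem_of_isHilbertSum h.hilbertSum n
  have hj' := (hT.isInvariant_basisSpan_iff.mp (h.invariant j)).mem_of_connected
    (connected_word l n) hj
  obtain ⟨r, hr⟩ := word_eq (T := T) l
  rw [hr] at hl hj' ⊢
  obtain ⟨θ, hθ, hθn⟩ := exists_commutes_of_same hl
  rw [← hθn] at hj' ⊢
  exact (hT.apply_eq_of_isIrreducible (h.irreducible j) hθ hj hj').symm

theorem Implements.same_injective (hT : T.Implements ρ b) {J : Type} {I : J → Set ℕ}
    (h : IsIrreducibleDecomposition ρ b I)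
    (hne : ∀ j k : J, j ≠ k → ¬ UnitarilyEquivalent
      (subrep ρ (basisSpan b (I j)) (h.invariant j)) (subrep ρ (basisSpan b (I k)) (h.invariant k)))
    (m n : ℕ) (hs : T.Same m n) : m = n := by
  have hreg := hT.codingPartiallyInjective h
  have hinv := fun j => hT.isInvariant_basisSpan_iff.mp (h.invariant j)
  have hinj : ∀ j, ∀ m ∈ I j, ∀ n ∈ I j, T.Same m n → m = n := fun j m hm n hn hs =>
    eq_of_same_of_connected hreg (hT.subset_of_isIrreducible (h.irreducible j)
      (invariant_connected m) hm ⟨0, 0, 0, by simp⟩ hn) hs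
  obtain ⟨j, hj⟩ := exists_mem_of_isHilbertSum h.hilbertSum m
  obtain ⟨k, hk⟩ := exists_mem_of_isHilbertSum h.hilbertSum n
  by_cases hjk : j = k
  · subst hjk
    exact hinj j m hj n hk hs
  -- The indices whose code occurs in `I k` form an invariant set meeting `I j`, so by minimality
  -- every code of `I j` occurs in `I k`; the converse is symmetric.
  · have hjk' := hT.subset_of_isIrreducible (h.irreducible j) (hinv k).saturation hj ⟨n, hk, hs⟩
    have hkj' := hT.subset_of_isIrreducible (h.irreducible k) (hinv j).saturation hk
      ⟨m, hj, hs.symm⟩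
    obtain ⟨θ, hθ, hθI⟩ := exists_commutes_swap (hinv j) (hinv k)
      (disjoint_of_isHilbertSum h.hilbertSum hjk) (hinj j) (hinj k) hjk' hkj'
    exact absurd (hT.unitarilyEquivalent (h.invariant j) (h.invariant k) hθ hθI) (hne j k hjk)

end TwoAdicSystem

end

theorem mainTheorem5 {H : Type u} [NormedAddCommGroup H] [InnerProductSpace ℂ H] [CompleteSpace H]
    (ρ : TwoAdicRingAlgebra.{u} →⋆ₐ[ℂ] (H →L[ℂ] H)) (b : HilbertBasis ℕ ℂ H)
    (hρ : TwoAdicRingAlgebra.IsPermutative ρ b) :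
    (CuntzAlgebra.IsRegular (CuntzAlgebra.restrict ρ) b ↔
      Rep.DecomposesIntoIrreducibles ρ b) ∧
    (CuntzAlgebra.IsMultiplicityFree (CuntzAlgebra.restrict ρ) b ↔
      Rep.DecomposesIntoDistinctIrreducibles ρ b) := by
  obtain ⟨T, hT⟩ := hρ.exists_implements
  rw [hT.isRegular_iff, hT.isMultiplicityFree_iff]
  refine ⟨⟨fun h => ⟨_, _, hT.isIrreducibleDecomposition h⟩, ?_⟩, fun h => ?_, ?_⟩
  · rintro ⟨J, I, h⟩
    exact hT.codingPartiallyInjective h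
  · have hreg : T.branching.CodingPartiallyInjective := fun n l hl =>
      h _ _ (TwoAdicSystem.coding_eq_iff.mp hl)
    refine ⟨_, _, hT.isIrreducibleDecomposition hreg, fun j k hjk => ?_⟩
    -- With globally injective codes, no index of another orbit shares the code of `n`.
    obtain ⟨n, rfl⟩ := Quotient.exists_rep j
    refine hT.not_unitarilyEquivalent _ _ (n := n) rfl fun m hm hs => hjk ?_
    rw [h n m hs]
    exact hm
  · rintro ⟨J, I, h, hne⟩
    exact hT.same_injective h hne
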